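/- **Proposition.** Let $n\ge 1$, put $v=\sqrt{n/(n+1)}$ and $\alpha_{\max}=\frac{1}{n+1}v^{2n}$, and let $\alpha\in(0,\alpha_{\max})$. Put $V_\alpha(u)=u^2-1+\alpha u^{-2n}$ and let $u_\alpha>0$ be its largest root. Let $\mathfrak c_{n-1}$ be the metric of complex hyperbolic space $\mathbb{CH}^{n-1}$ of constant holomorphic sectional curvature $-4$, that is, on the unit ball of $\mathbb C^{n-1}$, $$\mathfrak c_{n-1}=\frac{|dz|^2}{1-|z|^2}+\frac{|\langle z,dz\rangle|^2}{(1-|z|^2)^2},\qquad \langle z,v\rangle=\sum_i \bar z_i v_i .$$ On $\mathbb{CH}^{n-1}\times S^1\times(u_\alpha,\infty)$, with coordinates $(z,\theta,u)$, let $$\lambda_\alpha=u^2\,\mathfrak c_{n-1}+u^2V_\alpha(u)\,\eta^2+\frac{1}{V_\alpha(u)}\,du^2,\qquad \eta=d\theta+\frac{\operatorname{Im}\langle z,dz\rangle}{1-|z|^2}.$$ (For $\alpha=0$ and $u=\cosh r>1$ this is the metric of $\mathbb{CH}^n$ in polar coordinates $(\theta,r)$ about a totally geodesic $\mathbb{CH}^{n-1}$;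 $\eta$ is the $1$-form that equals $1$ on $\partial/\partial\theta$ and vanishes on $\partial/\partial u$ and on the horizontal distribution.) Then $\lambda_\alpha$ is a smooth Riemannian metric, and: 1. there is a constant $\kappa>0$ such that all sectional curvatures of $\lambda_\alpha$ are at most $-\kappa$; 2. at each point with coordinate $u$, the sectional curvature $K$ of every tangent $2$-plane satisfies $$-4-\frac{2n(n-1)\alpha}{u^{2n+2}}\;\le\; K\;\le\; -1+\frac{n\alpha}{u^{2n+2}}.$$ -/

import Mathlib

open scoped ContDiff

/-! ## Riemannian geometry on an open subset of a normed space

A metric on an open subset `U` of a finite-dimensional real normed space `E` is a map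
`g : E → E →L[ℝ] E →L[ℝ] ℝ`; only its values on `U` matter. -/

section Riemannian

variable {E : Type*} [NormedAddCommGroup E] [NormedSpace ℝ E]

/-- `g` is a smooth Riemannian metric on the open set `U`. -/
structure IsRiemannianMetricOn (g : E → E →L[ℝ] E →L[ℝ] ℝ) (U : Set E) : Prop where
  isOpen : IsOpen U
  contDiffOn : ContDiffOn ℝ ∞ g U
  symm : ∀ x ∈ U, ∀ X Y : E, g x X Y = g x Y X
  pos : ∀ x ∈ U, ∀ X : E, X ≠ 0 → 0 < g x X X

/-- The Koszul form of the constant vector fields `X`, `Y`: the linear form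
`Z ↦ ½ (X(g(Y,Z)) + Y(g(X,Z)) - Z(g(X,Y)))` at the point `x`. -/
noncomputable def koszulForm (g : E → E →L[ℝ] E →L[ℝ] ℝ) (x X Y : E) : E →L[ℝ] ℝ :=
  (1 / 2 : ℝ) • (fderiv ℝ g x X Y + fderiv ℝ g x Y X - ((fderiv ℝ g x).flip X).flip Y)

/-- The Christoffel map of the Levi-Civita connection: `Γ_x(X,Y) = (∇_X Y)(x)` for constant
vector fields `X`, `Y`, i.e. the vector with `g_x(Γ_x(X,Y), Z) = koszulForm g x X Y Z`
for all `Z`. -/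
noncomputable def christoffel (g : E → E →L[ℝ] E →L[ℝ] ℝ) (x X Y : E) : E :=
  (g x).inverse (koszulForm g x X Y)

/-- The Riemann curvature tensor `R(X,Y)Z = ∇_X ∇_Y Z - ∇_Y ∇_X Z - ∇_{[X,Y]} Z` at `x`
(evaluated on constant vector fields, for which `[X,Y] = 0`). -/
noncomputable def riemannCurvature (g : E → E →L[ℝ] E →L[ℝ] ℝ) (x X Y Z : E) : E :=
  fderiv ℝ (fun y => christoffel g y Y Z) x X - fderiv ℝ (fun y => christoffel g y X Z) x Y
    + christoffel g x X (christoffel g x Y Z) - christoffel g x Y (christoffel g x X Z)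

/-- The sectional curvature at `x` of the plane spanned by the linearly independent vectors
`X`, `Y`. -/
noncomputable def sectionalCurvature (g : E → E →L[ℝ] E →L[ℝ] ℝ) (x X Y : E) : ℝ :=
  g x (riemannCurvature g x X Y Y) X / (g x X X * g x Y Y - g x X Y ^ 2)

/-- The Christoffel map of a positive definite metric on a finite-dimensional space is
characterized by the Koszul formula. -/
theorem christoffel_eq_iff [FiniteDimensional ℝ E] (g : E → E →L[ℝ] E →L[ℝ] ℝ) (x X Y G : E)
    (hpos : ∀ Z : E, Z ≠ 0 → 0 < g x Z Z) :
    christoffel g x X Y = G ↔ ∀ Z : E, g x G Z = koszulForm g x X Y Z := by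
  have hinj : Function.Injective (g x) := by
    rw [injective_iff_map_eq_zero]
    intro Z hZ
    by_contra hne
    have := hpos Z hne
    rw [hZ] at this
    simp at this
  have hfr : Module.finrank ℝ E = Module.finrank ℝ (E →L[ℝ] ℝ) := by
    rw [← (LinearMap.toContinuousLinearMap (𝕜 := ℝ) (E := E) (F' := ℝ)).finrank_eq]
    exact (Subspace.dual_finrank_eq (K := ℝ) (V := E)).symm
  let e : E ≃L[ℝ] (E →L[ℝ] ℝ) :=
    (LinearEquiv.ofInjectiveOfFinrankEq (g x).toLinearMap hinj hfr).toContinuousLinearEquiv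
  have he : (e : E →L[ℝ] (E →L[ℝ] ℝ)) = g x := by
    ext Z W
    rfl
  have hi : christoffel g x X Y = e.symm (koszulForm g x X Y) := by
    unfold christoffel
    rw [← he, ContinuousLinearMap.inverse_equiv]
    rfl
  rw [hi, e.symm_apply_eq, eq_comm]
  constructor
  · intro h Z
    rw [← h, ← he]
    rfl
  · intro h
    ext Z
    rw [← h Z, ← he]
    rfl

end Riemannian

/-! ## Complex hyperbolic space -/

section Hyperbolic

variable {H : Type*} [NormedAddCommGroup H] [InnerProductSpace ℂ H]

/-- The real bilinear form `(v, w) ↦ Re ⟨v, w⟩`. -/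
noncomputable def hermRe : H →L[ℝ] H →L[ℝ] ℝ :=
  LinearMap.mkContinuous₂
    (LinearMap.mk₂ ℝ (fun v w : H => (inner ℂ v w).re)
      (fun v v' w => by simp)
      (fun c v w => by
        rw [← algebraMap_smul ℂ c v, inner_smul_left]
        simp)
      (fun v w w' => by simp)
      (fun c v w => by
        rw [← algebraMap_smul ℂ c w, inner_smul_right]
        simp))
    1 (fun v w => by
      rw [one_mul]
      exact (Complex.abs_re_le_norm _).trans (norm_inner_le_norm v w))

/-- The real linear form `v ↦ Im ⟨z, v⟩`. -/
noncomputable def hermIm (z : H) : H →L[ℝ] ℝ :=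
  Complex.imCLM ∘L (innerSL ℂ z).restrictScalars ℝ

/-- The square `a ⊗ a` of a linear form. -/
noncomputable def formSq {E : Type*} [NormedAddCommGroup E] [NormedSpace ℝ E]
    (a : E →L[ℝ] ℝ) : E →L[ℝ] E →L[ℝ] ℝ :=
  a.smulRight a

/-- The Riemannian metric of complex hyperbolic space in the unit ball model
`{z | ‖z‖ < 1}`, normalized to have constant holomorphic sectional curvature `-4`:
`Re⟨v, v'⟩ / (1 - ‖z‖²) + Re (conj ⟨z, v⟩ ⟨z, v'⟩) / (1 - ‖z‖²)²`. -/
noncomputable def complexHyperbolicMetric (z : H) : H →L[ℝ] H →L[ℝ] ℝ :=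
  (1 - ‖z‖ ^ 2)⁻¹ • hermRe
    + ((1 - ‖z‖ ^ 2) ^ 2)⁻¹ • (formSq (hermRe z) + formSq (hermIm z))

theorem hermRe_apply (v w : H) : hermRe v w = (inner ℂ v w).re := rfl

theorem hermIm_apply (z v : H) : hermIm z v = (inner ℂ z v).im := rfl

theorem complexHyperbolicMetric_apply (z v w : H) :
    complexHyperbolicMetric z v w = (1 - ‖z‖ ^ 2)⁻¹ * (inner ℂ v w).re
      + ((1 - ‖z‖ ^ 2) ^ 2)⁻¹ * ((starRingEnd ℂ) (inner ℂ z v) * inner ℂ z w).re := by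
  simp [complexHyperbolicMetric, formSq, hermRe_apply, hermIm_apply, Complex.mul_re,
    -inner_conj_symm]
  ring

end Hyperbolic

/-! ## The warped metrics `λ`

The manifold `ℂH^{n-1} × S¹ × (u₀, ∞)` is realized as the open set of all `(z, w)` in
`ℂ^{n-1} × ℂ` with `‖z‖ < 1` and `‖w‖ > u₀`, where `w = u e^{iθ}` encodes `(θ, u)`. -/

/-- The ambient real vector space `ℂ^{n-1} × ℂ`. -/
abbrev ModelSpace (n : ℕ) : Type := EuclideanSpace ℂ (Fin (n - 1)) × ℂ

/-- The 1-form `du`, where `u = ‖w‖`. -/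
noncomputable def duForm {n : ℕ} (p : ModelSpace n) : ModelSpace n →L[ℝ] ℝ :=
  ‖p.2‖⁻¹ • (hermRe p.2 ∘L ContinuousLinearMap.snd ℝ _ _)

/-- The 1-form which the metric writes as `dθ`: it is dual to `∂/∂θ` in the frame
`(X_i, ∂/∂θ, ∂/∂u)`, i.e. it is `1` on `∂/∂θ` and vanishes on `∂/∂u` and on the (nonintegrable)
horizontal distribution of `ℂH^n` over `ℂH^{n-1}`. In terms of the coordinate `θ = arg w` it is
`d(arg w) + Im ⟨z, dz⟩ / (1 - ‖z‖²)`. -/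
noncomputable def thetaForm {n : ℕ} (p : ModelSpace n) : ModelSpace n →L[ℝ] ℝ :=
  (‖p.2‖ ^ 2)⁻¹ • (hermIm p.2 ∘L ContinuousLinearMap.snd ℝ _ _)
    + (1 - ‖p.1‖ ^ 2)⁻¹ • (hermIm p.1 ∘L ContinuousLinearMap.fst ℝ _ _)

/-- The metric `λ = u² 𝔠_{n-1} + u² V(u) dθ² + V(u)⁻¹ du²`. -/
noncomputable def warpedMetric (n : ℕ) (V : ℝ → ℝ) (p : ModelSpace n) :
    ModelSpace n →L[ℝ] ModelSpace n →L[ℝ] ℝ :=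
  ‖p.2‖ ^ 2 • (complexHyperbolicMetric p.1).bilinearComp
      (ContinuousLinearMap.fst ℝ _ _) (ContinuousLinearMap.fst ℝ _ _)
    + (‖p.2‖ ^ 2 * V ‖p.2‖) • formSq (thetaForm p)
    + (V ‖p.2‖)⁻¹ • formSq (duForm p)

theorem duForm_apply {n : ℕ} (p X : ModelSpace n) :
    duForm p X = ‖p.2‖⁻¹ * (inner ℂ p.2 X.2).re := rfl

theorem thetaForm_apply {n : ℕ} (p X : ModelSpace n) :
    thetaForm p X = (‖p.2‖ ^ 2)⁻¹ * (inner ℂ p.2 X.2).im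
      + (1 - ‖p.1‖ ^ 2)⁻¹ * (inner ℂ p.1 X.1).im := rfl

theorem warpedMetric_apply (n : ℕ) (V : ℝ → ℝ) (p X Y : ModelSpace n) :
    warpedMetric n V p X Y = ‖p.2‖ ^ 2 * complexHyperbolicMetric p.1 X.1 Y.1
      + ‖p.2‖ ^ 2 * V ‖p.2‖ * (thetaForm p X * thetaForm p Y)
      + (V ‖p.2‖)⁻¹ * (duForm p X * duForm p Y) := by
  simp [warpedMetric, formSq]

/-- Polar coordinates of `ℂH^n` about the totally geodesic `ℂH^{n-1} = {(z, 0)}`, in the unit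
ball of `ℂ^{n-1} ⊕ ℂ`: the point over `z` at distance `r` from `ℂH^{n-1}` and with angle `θ`,
where `w = cosh r e^{iθ}`; note `√(1 - ‖w‖⁻²) = tanh r`. -/
noncomputable def polarMap (n : ℕ) (p : ModelSpace n) :
    WithLp 2 (EuclideanSpace ℂ (Fin (n - 1)) × ℂ) :=
  WithLp.toLp 2 (p.1, (√(1 - ‖p.1‖ ^ 2) * √(‖p.2‖ ^ 2 - 1) / ‖p.2‖ ^ 2) • p.2)

theorem hasFDerivAt_norm_sq_hermRe {H : Type*} [NormedAddCommGroup H] [InnerProductSpace ℂ H]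
    (z : H) : HasFDerivAt (fun q : H => ‖q‖ ^ 2) ((2 : ℝ) • hermRe z) z := by
  have h := (hermRe (H := H)).hasFDerivAt_of_bilinear (hasFDerivAt_id z) (hasFDerivAt_id z)
  refine (h.congr_fderiv ?_).congr_of_eventuallyEq (.of_forall fun q => ?_)
  · ext X
    have : (inner ℂ X z).re = (inner ℂ z X).re := inner_re_symm (𝕜 := ℂ) X z
    simp [hermRe_apply, two_mul, this]
  · exact norm_sq_eq_re_inner (𝕜 := ℂ) q

theorem hasFDerivAt_polarMap (n : ℕ) (p : ModelSpace n) (hz : ‖p.1‖ < 1) (hw : 1 < ‖p.2‖) :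
    ∃ L : ModelSpace n →L[ℝ] WithLp 2 (EuclideanSpace ℂ (Fin (n - 1)) × ℂ),
      HasFDerivAt (polarMap n) L p ∧ ∀ X : ModelSpace n,
        L X = WithLp.toLp 2 (X.1,
          (√(1 - ‖p.1‖ ^ 2) * √(‖p.2‖ ^ 2 - 1) / ‖p.2‖ ^ 2) •
            ((-(inner ℂ p.1 X.1).re / (1 - ‖p.1‖ ^ 2)
              + (inner ℂ p.2 X.2).re / (‖p.2‖ ^ 2 - 1)
              - 2 * (inner ℂ p.2 X.2).re / ‖p.2‖ ^ 2) • p.2 + X.2)) := by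
  have hz' : 0 < 1 - ‖p.1‖ ^ 2 := by nlinarith [norm_nonneg p.1]
  have hw' : 0 < ‖p.2‖ ^ 2 - 1 := by nlinarith
  have hs : ‖p.2‖ ^ 2 ≠ 0 := by linarith
  have h1 := ((((hasFDerivAt_norm_sq_hermRe p.1).comp p
    (hasFDerivAt_fst (𝕜 := ℝ) (p := p))).const_sub 1).sqrt hz'.ne')
  have h2 := (hasFDerivAt_norm_sq_hermRe p.2).comp p (hasFDerivAt_snd (𝕜 := ℝ) (p := p))
  have h3 := ((h2.sub_const 1).sqrt hw'.ne')
  have h4 := ((h1.mul h3).mul ((hasDerivAt_inv hs).comp_hasFDerivAt p h2)).smul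
    (hasFDerivAt_snd (𝕜 := ℝ) (p := p))
  have h5 := (WithLp.prodContinuousLinearEquiv 2 ℝ
    (EuclideanSpace ℂ (Fin (n - 1))) ℂ).symm.toContinuousLinearMap.hasFDerivAt.comp p
    ((hasFDerivAt_fst (𝕜 := ℝ) (p := p)).prodMk h4)
  refine ⟨_, h5, fun X => ?_⟩
  have ha := Real.sq_sqrt hz'.le
  have hb := Real.sq_sqrt hw'.le
  have ha0 := Real.sqrt_pos.2 hz'
  have hb0 := Real.sqrt_pos.2 hw'
  refine congrArg (fun t => WithLp.toLp 2 (X.1, t)) ?_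
  simp only [one_div, Complex.real_smul]
  simp [hermRe_apply]
  have hA : (1 : ℂ) - (‖p.1‖ : ℂ) ^ 2 = (√(1 - ‖p.1‖ ^ 2) : ℂ) ^ 2 := by
    rw [← Complex.ofReal_pow √_, ha]
    push_cast
    rfl
  have hB : (‖p.2‖ : ℂ) ^ 2 - 1 = (√(‖p.2‖ ^ 2 - 1) : ℂ) ^ 2 := by
    rw [← Complex.ofReal_pow √_, hb]
    push_cast
    rfl
  have hA0 : (√(1 - ‖p.1‖ ^ 2) : ℂ) ≠ 0 := Complex.ofReal_ne_zero.2 ha0.ne'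
  have hB0 : (√(‖p.2‖ ^ 2 - 1) : ℂ) ≠ 0 := Complex.ofReal_ne_zero.2 hb0.ne'
  have hs0 : (‖p.2‖ : ℂ) ≠ 0 := Complex.ofReal_ne_zero.2 (by linarith)
  rw [hA, hB]
  field_simp
  ring

/-- For `V(u) = u² - 1` the metric `λ` is the complex hyperbolic metric in polar coordinates. -/
theorem warpedMetric_eq_pullback (n : ℕ) (p : ModelSpace n) (hz : ‖p.1‖ < 1) (hw : 1 < ‖p.2‖)
    (X Y : ModelSpace n) :
    complexHyperbolicMetric (polarMap n p) (fderiv ℝ (polarMap n) p X)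
        (fderiv ℝ (polarMap n) p Y)
      = warpedMetric n (fun u => u ^ 2 - 1) p X Y := by
  obtain ⟨L, hL, hLX⟩ := hasFDerivAt_polarMap n p hz hw
  rw [hL.fderiv, hLX, hLX, complexHyperbolicMetric_apply, warpedMetric_apply,
    complexHyperbolicMetric_apply, polarMap]
  obtain ⟨z, w⟩ := p
  obtain ⟨v, x⟩ := X
  obtain ⟨v', x'⟩ := Y
  have hz' : 0 < 1 - ‖z‖ ^ 2 := by nlinarith [norm_nonneg z]
  have hw' : 0 < ‖w‖ ^ 2 - 1 := by nlinarith
  have hs : ‖w‖ ^ 2 ≠ 0 := by linarith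
  have hxx : (inner ℂ x x').re * ‖w‖ ^ 2 = (inner ℂ w x).re * (inner ℂ w x').re
      + (inner ℂ w x).im * (inner ℂ w x').im := by
    rw [Complex.sq_norm, Complex.normSq_apply]
    simp
    ring
  have hc : (√(1 - ‖z‖ ^ 2) * √(‖w‖ ^ 2 - 1) / ‖w‖ ^ 2) ^ 2
      = (1 - ‖z‖ ^ 2) * (‖w‖ ^ 2 - 1) / (‖w‖ ^ 2) ^ 2 := by
    rw [div_pow, mul_pow, Real.sq_sqrt hz'.le, Real.sq_sqrt hw'.le]
  have key : ∀ (c k k' : ℝ), inner ℂ (c • (k • w + x)) (c • (k' • w + x'))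
      = ((c ^ 2 : ℝ) : ℂ) * (k * k' * ((‖w‖ ^ 2 : ℝ) : ℂ) + k * inner ℂ w x'
        + k' * (starRingEnd ℂ) (inner ℂ w x) + inner ℂ x x') := by
    intro c k k'
    rw [Complex.sq_norm, Complex.normSq_eq_conj_mul_self]
    simp
    ring
  have key2 : ∀ (c k : ℝ), inner ℂ (c • w) (c • (k • w + x))
      = ((c ^ 2 : ℝ) : ℂ) * (k * ((‖w‖ ^ 2 : ℝ) : ℂ) + inner ℂ w x) := by
    intro c k
    rw [Complex.sq_norm, Complex.normSq_eq_conj_mul_self]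
    simp
    ring
  have key3 : ∀ (c k : ℝ), inner ℂ (c • w) (c • (k • w + x'))
      = ((c ^ 2 : ℝ) : ℂ) * (k * ((‖w‖ ^ 2 : ℝ) : ℂ) + inner ℂ w x') := by
    intro c k
    rw [Complex.sq_norm, Complex.normSq_eq_conj_mul_self]
    simp
    ring
  have key4 : ∀ c : ℝ, ‖c • w‖ ^ 2 = c ^ 2 * ‖w‖ ^ 2 := by
    intro c
    rw [norm_smul, mul_pow, Real.norm_eq_abs, sq_abs]
  simp only [thetaForm_apply, duForm_apply, WithLp.prod_inner_apply,
    WithLp.prod_norm_sq_eq_of_L2, WithLp.toLp_fst, WithLp.toLp_snd]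
  rw [key, key2, key3, key4, hc]
  have hsq : ‖w‖⁻¹ * (inner ℂ w x).re * (‖w‖⁻¹ * (inner ℂ w x').re)
      = (‖w‖ ^ 2)⁻¹ * ((inner ℂ w x).re * (inner ℂ w x').re) := by
    rw [sq, mul_inv]
    ring
  rw [hsq]
  have hxx' : (inner ℂ x x').re = ((inner ℂ w x).re * (inner ℂ w x').re
      + (inner ℂ w x).im * (inner ℂ w x').im) / ‖w‖ ^ 2 := by
    rw [eq_div_iff hs, hxx]
  have hden : 1 - (‖z‖ ^ 2 + (1 - ‖z‖ ^ 2) * (‖w‖ ^ 2 - 1) / (‖w‖ ^ 2) ^ 2 * ‖w‖ ^ 2)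
      = (1 - ‖z‖ ^ 2) / ‖w‖ ^ 2 := by
    field_simp
    ring
  rw [hden]
  simp only [Complex.add_re, Complex.add_im, Complex.mul_re, Complex.mul_im, Complex.conj_re,
    Complex.conj_im, Complex.ofReal_re, Complex.ofReal_im]
  rw [hxx']
  clear hxx hxx' hden hsq key key2 key3 key4 hc hLX hL
  generalize inner ℂ w x = e at *
  generalize inner ℂ w x' = e' at *
  generalize inner ℂ z v = d at *
  generalize inner ℂ z v' = d' at *
  generalize inner ℂ v v' = m at *
  generalize ‖w‖ ^ 2 = s at *
  generalize 1 - ‖z‖ ^ 2 = a at *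
  obtain ⟨b, rfl⟩ : ∃ b, s = b + 1 := ⟨s - 1, by ring⟩
  simp only [add_sub_cancel_right] at *
  field_simp
  ring

/-! ## The model Einstein metrics `λ_α` -/

/-- `V_α(u) = u² - 1 + α / u^{2n}`. -/
noncomputable def modelV (n : ℕ) (α u : ℝ) : ℝ := u ^ 2 - 1 + α / u ^ (2 * n)

/-- `α_max = v^{2n} / (n + 1)` with `v = √(n / (n + 1))`. -/
noncomputable def alphaMax (n : ℕ) : ℝ := 1 / (n + 1) * √(n / (n + 1)) ^ (2 * n)

/-- `u_α`, the largest (positive) root of `V_α`. -/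
noncomputable def rootU (n : ℕ) (α : ℝ) : ℝ := sSup {u : ℝ | 0 < u ∧ modelV n α u = 0}

/-- The manifold `ℂH^{n-1} × S¹ × (u_α, ∞)` on which `λ_α` lives. -/
def modelDomain (n : ℕ) (α : ℝ) : Set (ModelSpace n) :=
  {p | ‖p.1‖ < 1 ∧ rootU n α < ‖p.2‖}

/-- The model Einstein metric `λ_α`. -/
noncomputable def modelMetric (n : ℕ) (α : ℝ) :
    ModelSpace n → ModelSpace n →L[ℝ] ModelSpace n →L[ℝ] ℝ :=
  warpedMetric n (modelV n α)

/-- For `0 < α ≤ α_max` the supremum in the definition of `u_α` is attained. -/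
theorem isGreatest_rootU (n : ℕ) (hn : 1 ≤ n) (α : ℝ) (h0 : 0 < α) (h1 : α ≤ alphaMax n) :
    IsGreatest {u : ℝ | 0 < u ∧ modelV n α u = 0} (rootU n α) := by
  have hS : {u : ℝ | 0 < u ∧ modelV n α u = 0}
      = {u : ℝ | 0 ≤ u ∧ u ^ (2 * n) * (u ^ 2 - 1) + α = 0} := by
    ext u
    simp only [Set.mem_ofPred_eq, modelV]
    constructor
    · rintro ⟨hu, h⟩
      refine ⟨hu.le, ?_⟩
      field_simp at h
      linarith
    · rintro ⟨hu, h⟩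
      have hu' : 0 < u := by
        rcases hu.lt_or_eq with h' | h'
        · exact h'
        · subst h'
          rw [zero_pow (by omega)] at h
          linarith
      refine ⟨hu', ?_⟩
      field_simp
      linarith
  have hbd : BddAbove {u : ℝ | 0 < u ∧ modelV n α u = 0} := by
    refine ⟨1, ?_⟩
    rintro u ⟨hu, h⟩
    by_contra! hlt
    have : 0 < α / u ^ (2 * n) := by positivity
    unfold modelV at h
    nlinarith
  have hcl : IsClosed {u : ℝ | 0 < u ∧ modelV n α u = 0} := by
    rw [hS]
    exact (isClosed_le continuous_const continuous_id).inter
      (isClosed_eq (by fun_prop) continuous_const)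
  have hne : {u : ℝ | 0 < u ∧ modelV n α u = 0}.Nonempty := by
    rw [hS]
    have hn' : (0 : ℝ) < n := by exact_mod_cast hn
    set v : ℝ := √(n / (n + 1)) with hv
    have hv2 : v ^ 2 = n / (n + 1) := Real.sq_sqrt (by positivity)
    have hv0 : 0 ≤ v := Real.sqrt_nonneg _
    have hv1 : v ≤ 1 := by
      rw [hv, Real.sqrt_le_one, div_le_one (by positivity)]
      linarith
    have hc : ContinuousOn (fun u : ℝ => u ^ (2 * n) * (u ^ 2 - 1) + α) (Set.Icc v 1) := by
      fun_prop
    have hmem : (0 : ℝ) ∈ Set.Icc (v ^ (2 * n) * (v ^ 2 - 1) + α)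
        (1 ^ (2 * n) * (1 ^ 2 - 1) + α) := by
      constructor
      · have h2 : v ^ (2 * n) * (v ^ 2 - 1) = - alphaMax n := by
          rw [hv2, alphaMax, ← hv]
          field_simp
          ring
        rw [h2]
        linarith
      · simpa using h0.le
    obtain ⟨u, hu, h⟩ := intermediate_value_Icc hv1 hc hmem
    exact ⟨u, hv0.trans hu.1, h⟩
  exact ⟨hcl.csSup_mem hne hbd, fun u hu => le_csSup hbd hu⟩

/-! The curvature is computed in a moving frame adapted to the fibration over the ball. With s = u²
and V = v(s), put ζ = du/(uV) + iη. In the coframe (dz, ζ) the metric is the real part of the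
Hermitian form s·h + s·v(s)·|ζ|², where h (`ballForm`) is the Hermitian form of the ball; working
with s rather than u keeps every coefficient smooth and every derivative polynomial in the frame
data. The only structure equation with content is dζ = 2i Im h, the curvature of the circle bundle
(`verticalFormDeriv_sub`). From it one reads off a connection form that is complex linear on frame
vectors, so the metric is Kähler for the complex structure of the frame. It is torsion free and
metric, hence Levi-Civita (`isLeviCivitaFrame`), and dψ + [ψ, ψ] gives the curvature for every
profile v (`frameCurvature`).

For v = s - 1 + α s^(-n) put τ = α/u^(2n+2). Then (1 + v)/s = 1 + τ, v' = 1 - nτ and 2(2v' + s v'')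
= 4 + 2n(n-1)τ. These three numbers weight the horizontal, mixed and vertical parts of -K
(`warpedMetric_riemannCurvature`). What remains is algebra with the Cauchy-Schwarz inequality: -K
lies between the mixed weight 1 - nτ (`curvature_upper_bound`) and the vertical weight 4 + 2n(n-1)τ
(`curvature_lower_bound`).

Finally, nτ stays away from 1: u_α is at least the point where u^(2n) V is minimal, and there α <
α_max gives nα < u^(2n+2) (`mul_div_rootU_pow_lt_one`). This yields κ. -/

/-! ### Levi-Civita connection and curvature in a moving frame. -/

section MovingFrame

variable {E F : Type*} [NormedAddCommGroup E] [NormedSpace ℝ E]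
  [NormedAddCommGroup F] [NormedSpace ℝ F]

/-- The Levi-Civita connection of `g` on the open set `U`, expressed in a moving frame:
`A p : E → F` is the coframe at `p`, `B p` its inverse, and `ψ p X` is the connection form, so that
`∇_X Y` corresponds to `(D_X A) Y + ψ(X) (A Y)` for constant vector fields `X`, `Y`. -/
structure IsLeviCivitaFrame (g : E → E →L[ℝ] E →L[ℝ] ℝ) (A : E → E →L[ℝ] F)
    (B : E → F →L[ℝ] E) (ψ : E → E → F →L[ℝ] F) (U : Set E) : Prop where
  isOpen : IsOpen U
  symm : ∀ x ∈ U, ∀ X Y : E, g x X Y = g x Y X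
  pos : ∀ x ∈ U, ∀ X : E, X ≠ 0 → 0 < g x X X
  contDiffOn_coframe : ContDiffOn ℝ 2 A U
  differentiableAt_frame : ∀ x ∈ U, DifferentiableAt ℝ B x
  differentiableAt_connection : ∀ x ∈ U, ∀ X, DifferentiableAt ℝ (fun y => ψ y X) x
  coframe_frame : ∀ x ∈ U, ∀ a, A x (B x a) = a
  torsion : ∀ x ∈ U, ∀ X Y, fderiv ℝ A x X Y + ψ x X (A x Y) = fderiv ℝ A x Y X + ψ x Y (A x X)
  metric : ∀ x ∈ U, ∀ X Y Z, fderiv ℝ g x X Y Z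
    = g x (B x (fderiv ℝ A x X Y + ψ x X (A x Y))) Z
      + g x Y (B x (fderiv ℝ A x X Z + ψ x X (A x Z)))

variable {g : E → E →L[ℝ] E →L[ℝ] ℝ} {A : E → E →L[ℝ] F} {B : E → F →L[ℝ] E}
  {ψ : E → E → F →L[ℝ] F} {U : Set E}

/-- The usual uniqueness argument: in the alternating sum of the three cyclic instances of metric
compatibility, vanishing torsion cancels the mixed terms and leaves the Koszul formula. -/
theorem IsLeviCivitaFrame.christoffel_eq [FiniteDimensional ℝ E]
    (h : IsLeviCivitaFrame g A B ψ U) {x : E} (hx : x ∈ U) (X Y : E) :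
    christoffel g x X Y = B x (fderiv ℝ A x X Y + ψ x X (A x Y)) := by
  rw [christoffel_eq_iff g x X Y _ (h.pos x hx)]
  intro Z
  have e1 := h.metric x hx X Y Z
  have e2 := h.metric x hx Y X Z
  have e3 := h.metric x hx Z X Y
  have s1 := h.symm x hx Y (B x (fderiv ℝ A x X Z + ψ x X (A x Z)))
  have s2 := h.symm x hx X (B x (fderiv ℝ A x Y Z + ψ x Y (A x Z)))
  have s3 := h.symm x hx X (B x (fderiv ℝ A x Z Y + ψ x Z (A x Y)))
  rw [h.torsion x hx Y X, h.torsion x hx Y Z] at e2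
  rw [h.torsion x hx X Z] at e1 s1
  rw [h.torsion x hx Y Z] at s2
  simp only [koszulForm, smul_apply, add_apply,
    sub_apply, ContinuousLinearMap.flip_apply, smul_eq_mul]
  linarith

/-- Cartan's second structure equation: in a moving frame the curvature is `dψ + [ψ, ψ]`. -/
theorem IsLeviCivitaFrame.coframe_riemannCurvature [FiniteDimensional ℝ E]
    (h : IsLeviCivitaFrame g A B ψ U) {x : E} (hx : x ∈ U) (X Y Z : E) :
    A x (riemannCurvature g x X Y Z)
      = fderiv ℝ (fun y => ψ y Y) x X (A x Z) - fderiv ℝ (fun y => ψ y X) x Y (A x Z)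
        + ψ x X (ψ x Y (A x Z)) - ψ x Y (ψ x X (A x Z)) := by
  have hU : U ∈ nhds x := h.isOpen.mem_nhds hx
  have hA2 : ContDiffAt ℝ 2 A x := h.contDiffOn_coframe.contDiffAt hU
  have hA : DifferentiableAt ℝ A x := hA2.differentiableAt (by norm_num)
  have hdA : DifferentiableAt ℝ (fderiv ℝ A) x :=
    (hA2.fderiv_right (m := 1) (by norm_num)).differentiableAt (by norm_num)
  have hsymm : IsSymmSndFDerivAt ℝ A x := hA2.isSymmSndFDerivAt (by simp)
  -- Both sides differentiate A(∇_Y Z) = (D_Y A)Z + ψ(Y)(AZ) in the direction X, so the derivative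
  -- of the inverse frame B never appears.
  have key : ∀ X Y : E, A x (fderiv ℝ (fun y => christoffel g y Y Z) x X)
      + fderiv ℝ A x X (christoffel g x Y Z)
      = fderiv ℝ (fderiv ℝ A) x X Y Z + fderiv ℝ (fun y => ψ y Y) x X (A x Z)
        + ψ x Y (fderiv ℝ A x X Z) := by
    intro X Y
    have hF : DifferentiableAt ℝ (fun y => fderiv ℝ A y Y Z + ψ y Y (A y Z)) x :=
      ((hdA.clm_apply (differentiableAt_const Y)).clm_apply (differentiableAt_const Z)).add
        ((h.differentiableAt_connection x hx Y).clm_apply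
          (hA.clm_apply (differentiableAt_const Z)))
    have hC : DifferentiableAt ℝ (fun y => christoffel g y Y Z) x := by
      refine ((h.differentiableAt_frame x hx).clm_apply hF).congr_of_eventuallyEq ?_
      filter_upwards [hU] with y hy using h.christoffel_eq hy Y Z
    have h1 := hA.hasFDerivAt.clm_apply hC.hasFDerivAt
    have h2 := ((hdA.hasFDerivAt.clm_apply (hasFDerivAt_const Y x)).clm_apply
      (hasFDerivAt_const Z x)).add
        ((h.differentiableAt_connection x hx Y).hasFDerivAt.clm_apply
          (hA.hasFDerivAt.clm_apply (hasFDerivAt_const Z x)))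
    have h3 := h2.congr_of_eventuallyEq (f₁ := fun y => A y (christoffel g y Y Z)) (by
      filter_upwards [hU] with y hy
      rw [h.christoffel_eq hy Y Z, h.coframe_frame y hy]
      rfl)
    have h4 := DFunLike.congr_fun (h1.unique h3) X
    simpa [add_assoc, add_comm, add_left_comm] using h4
  have hch : ∀ X Y : E, A x (christoffel g x X Y) = fderiv ℝ A x X Y + ψ x X (A x Y) := by
    intro X Y
    rw [h.christoffel_eq hx, h.coframe_frame x hx]
  have k1 := key X Y
  have k2 := key Y X
  -- The second derivatives of A now agree and cancel on antisymmetrization; the terms ψ(Y)((D_X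
  -- A)Z) cancel against those from the iterated Christoffel maps.
  rw [hsymm.eq Y X] at k2
  simp only [riemannCurvature, map_add, map_sub]
  rw [hch X (christoffel g x Y Z), hch Y (christoffel g x X Z), hch X Z, hch Y Z,
    eq_sub_of_add_eq k1, eq_sub_of_add_eq k2, map_add, map_add]
  abel

end MovingFrame

/-! ### The Hermitian form, connection and curvature of the complex hyperbolic ball. -/

section Ball

open ComplexConjugate

variable {H : Type*} [NormedAddCommGroup H] [InnerProductSpace ℂ H]

/-- The Hermitian form whose real part is the complex hyperbolic metric. -/
noncomputable def ballForm (z x y : H) : ℂ :=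
  ((1 - ‖z‖ ^ 2)⁻¹ : ℝ) * inner ℂ x y
    + ((1 - ‖z‖ ^ 2)⁻¹ : ℝ) ^ 2 * (conj (inner ℂ z x) * inner ℂ z y)

/-- The Christoffel map of the complex hyperbolic metric. -/
noncomputable def ballChristoffel (z x y : H) : H :=
  (((1 - ‖z‖ ^ 2)⁻¹ : ℝ) : ℂ) • (inner ℂ z x • y + inner ℂ z y • x)

/-- The derivative of `ballChristoffel z y c` in the direction `x`. -/
noncomputable def ballChristoffelDeriv (z x y c : H) : H :=
  ((((1 - ‖z‖ ^ 2)⁻¹ : ℝ) : ℂ) ^ 2 * (inner ℂ z x + conj (inner ℂ z x)))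
      • (inner ℂ z y • c + inner ℂ z c • y)
    + (((1 - ‖z‖ ^ 2)⁻¹ : ℝ) : ℂ) • (inner ℂ x y • c + inner ℂ x c • y)

theorem re_ballForm (z x y : H) : (ballForm z x y).re = complexHyperbolicMetric z x y := by
  rw [complexHyperbolicMetric_apply, ballForm, ← Complex.ofReal_pow, Complex.add_re,
    Complex.re_ofReal_mul, Complex.re_ofReal_mul, inv_pow]

theorem conj_ballForm (z x y : H) : conj (ballForm z x y) = ballForm z y x := by
  simp only [ballForm, map_add, map_mul, map_pow, Complex.conj_ofReal, inner_conj_symm]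
  ring

theorem ballForm_add_right (z x y y' : H) :
    ballForm z x (y + y') = ballForm z x y + ballForm z x y' := by
  simp only [ballForm, inner_add_right]
  ring

theorem ballForm_smul_right (z x y : H) (c : ℂ) :
    ballForm z x (c • y) = c * ballForm z x y := by
  simp only [ballForm, inner_smul_right]
  ring

theorem ballForm_add_left (z x x' y : H) :
    ballForm z (x + x') y = ballForm z x y + ballForm z x' y := by
  simp only [ballForm, inner_add_left, inner_add_right, map_add]
  ring

theorem ballForm_smul_left (z x y : H) (c : ℂ) :
    ballForm z (c • x) y = conj c * ballForm z x y := by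
  simp only [ballForm, inner_smul_left, inner_smul_right, map_mul]
  ring

theorem ballForm_zero_left (z y : H) : ballForm z 0 y = 0 := by simp [ballForm]

theorem ballChristoffel_comm (z x y : H) : ballChristoffel z x y = ballChristoffel z y x := by
  rw [ballChristoffel, ballChristoffel, add_comm]

theorem ballChristoffel_add (z x y y' : H) :
    ballChristoffel z x (y + y') = ballChristoffel z x y + ballChristoffel z x y' := by
  simp only [ballChristoffel, inner_add_right]
  module

theorem ballChristoffel_smul (z x y : H) (c : ℂ) :
    ballChristoffel z x (c • y) = c • ballChristoffel z x y := by
  simp only [ballChristoffel, inner_smul_right]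
  module

/-- Complex hyperbolic space has constant holomorphic sectional curvature `-4`. -/
theorem ballChristoffel_curvature (z x y c : H) :
    ballChristoffelDeriv z x y c - ballChristoffelDeriv z y x c
      + ballChristoffel z x (ballChristoffel z y c) - ballChristoffel z y (ballChristoffel z x c)
      = (ballForm z x y - ballForm z y x) • c + ballForm z x c • y - ballForm z y c • x := by
  simp only [ballChristoffelDeriv, ballChristoffel, ballForm, inner_smul_right, inner_add_right]
  module

variable {z : ℝ → H} {x : H} {t : ℝ}

theorem hasDerivAt_inv_one_sub_norm_sq (hz : HasDerivAt z x t) (h1 : ‖z t‖ < 1) :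
    HasDerivAt (fun τ => (1 - ‖z τ‖ ^ 2)⁻¹)
      (((1 - ‖z t‖ ^ 2)⁻¹) ^ 2 * (2 * (inner ℂ (z t) x).re)) t := by
  have h0 : 1 - ‖z t‖ ^ 2 ≠ 0 := by nlinarith [norm_nonneg (z t)]
  have h2 : HasDerivAt (fun τ => ‖z τ‖ ^ 2) (2 * (inner ℂ (z t) x).re) t := by
    have := (hasFDerivAt_norm_sq_hermRe (z t)).comp_hasDerivAt t hz
    exact this
  refine ((h2.const_sub 1).inv h0).congr_deriv ?_
  field_simp

theorem hasDerivAt_inv_one_sub_norm_sq_complex (hz : HasDerivAt z x t) (h1 : ‖z t‖ < 1) :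
    HasDerivAt (fun τ => (((1 - ‖z τ‖ ^ 2)⁻¹ : ℝ) : ℂ))
      ((((1 - ‖z t‖ ^ 2)⁻¹ : ℝ) : ℂ) ^ 2 * (inner ℂ (z t) x + conj (inner ℂ (z t) x))) t := by
  refine (hasDerivAt_inv_one_sub_norm_sq hz h1).ofReal_comp.congr_deriv ?_
  rw [Complex.add_conj]
  push_cast
  ring

theorem hasDerivAt_inner_const (hz : HasDerivAt z x t) (y : H) :
    HasDerivAt (fun τ => inner ℂ (z τ) y) (inner ℂ x y) t := by
  simpa using hz.inner ℂ (hasDerivAt_const t y)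

/-- Metric compatibility. Together with the symmetry `ballChristoffel_comm` it is what makes
`ballChristoffel` the Levi-Civita connection of the ball. -/
theorem hasDerivAt_ballForm (hz : HasDerivAt z x t) (h1 : ‖z t‖ < 1) (y y' : H) :
    HasDerivAt (fun τ => ballForm (z τ) y y')
      (ballForm (z t) (ballChristoffel (z t) x y) y'
        + ballForm (z t) y (ballChristoffel (z t) x y')) t := by
  have hi := hasDerivAt_inv_one_sub_norm_sq_complex hz h1
  have hy := hasDerivAt_inner_const hz y
  have hy' := hasDerivAt_inner_const hz y'
  have hc : HasDerivAt (fun τ => conj (inner ℂ (z τ) y)) (conj (inner ℂ x y)) t :=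
    hy.star
  refine ((hi.mul_const (inner ℂ y y')).add ((hi.pow 2).mul (hc.mul hy'))).congr_deriv ?_
  simp only [ballForm, ballChristoffel, inner_smul_right, inner_smul_left, inner_add_left,
    inner_add_right, map_add, map_mul, Complex.conj_ofReal, inner_conj_symm]
  simp only [Pi.mul_apply, Pi.pow_apply]
  push_cast
  ring

theorem hasDerivAt_ballChristoffel (hz : HasDerivAt z x t) (h1 : ‖z t‖ < 1) (y c : H) :
    HasDerivAt (fun τ => ballChristoffel (z τ) y c) (ballChristoffelDeriv (z t) x y c) t := by
  have hi := hasDerivAt_inv_one_sub_norm_sq_complex hz h1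
  have hy := hasDerivAt_inner_const hz y
  have hc := hasDerivAt_inner_const hz c
  refine (hi.smul ((hy.smul_const c).add (hc.smul_const y))).congr_deriv ?_
  simp only [ballChristoffelDeriv, Pi.add_apply]
  module

end Ball

/-! ### Fréchet derivatives of known differentiable maps, evaluated along lines. -/

section FDeriv

variable {E F G : Type*} [NormedAddCommGroup E] [NormedSpace ℝ E]
  [NormedAddCommGroup F] [NormedSpace ℝ F] [NormedAddCommGroup G] [NormedSpace ℝ G]

theorem fderiv_apply_eq_of_hasDerivAt_line {f : E → F} {x X : E} {c : F}
    (hf : DifferentiableAt ℝ f x) (h : HasDerivAt (fun t : ℝ => f (x + t • X)) c 0) :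
    fderiv ℝ f x X = c := by
  rw [← hf.lineDeriv_eq_fderiv]
  exact h.deriv

theorem fderiv_clm_apply_eq_of_hasDerivAt_line {f : E → F →L[ℝ] G} {x X : E} {Y : F} {c : G}
    (hf : DifferentiableAt ℝ f x) (h : HasDerivAt (fun t : ℝ => f (x + t • X) Y) c 0) :
    fderiv ℝ f x X Y = c := by
  have h1 := fderiv_apply_eq_of_hasDerivAt_line (hf.clm_apply (differentiableAt_const Y)) h
  rw [fderiv_clm_apply hf (differentiableAt_const Y)] at h1
  simpa using h1

theorem hasDerivAt_line (x X : E) (t : ℝ) : HasDerivAt (fun τ : ℝ => x + τ • X) X t := by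
  simpa using ((hasDerivAt_id t).smul_const X).const_add x

end FDeriv

/-! ### The adapted coframe, its inverse and the connection form. -/

section Model

open ComplexConjugate

/-- A positive function `v` on `(s₀, ∞)` with its first two derivatives; the metric to be studied is
`warpedMetric n V` with `V u = v (u ^ 2)`. -/
structure IsWarpingProfile (v v₁ v₂ : ℝ → ℝ) (s₀ : ℝ) : Prop where
  nonneg : 0 ≤ s₀
  pos : ∀ s, s₀ < s → 0 < v s
  hasDerivAt : ∀ s, s₀ < s → HasDerivAt v (v₁ s) s
  hasDerivAt_deriv : ∀ s, s₀ < s → HasDerivAt v₁ (v₂ s) s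
  contDiffOn : ContDiffOn ℝ ∞ v (Set.Ioi s₀)
  contDiffOn_deriv : ContDiffOn ℝ ∞ v₁ (Set.Ioi s₀)

/-- The set of `(z, w)` with `‖z‖ < 1` and `s₀ < ‖w‖²`. -/
def profileDomain (n : ℕ) (s₀ : ℝ) : Set (ModelSpace n) := {p | ‖p.1‖ < 1 ∧ s₀ < ‖p.2‖ ^ 2}

variable {n : ℕ}

/-- The complex linear form `du / (u V) + i θ` on the vertical distribution. -/
noncomputable def verticalForm (v : ℝ → ℝ) (p : ModelSpace n) : ModelSpace n →L[ℝ] ℂ :=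
  ((‖p.2‖ ^ 2 * v (‖p.2‖ ^ 2))⁻¹ • (hermRe p.2 ∘L ContinuousLinearMap.snd ℝ _ _)).smulRight (1 : ℂ)
    + (thetaForm p).smulRight Complex.I

theorem verticalForm_apply (v : ℝ → ℝ) (p X : ModelSpace n) :
    verticalForm v p X = (((‖p.2‖ ^ 2 * v (‖p.2‖ ^ 2))⁻¹ * (inner ℂ p.2 X.2).re : ℝ) : ℂ)
      + (((‖p.2‖ ^ 2)⁻¹ * (inner ℂ p.2 X.2).im
        + (1 - ‖p.1‖ ^ 2)⁻¹ * (inner ℂ p.1 X.1).im : ℝ) : ℂ) * Complex.I := by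
  simp [verticalForm, hermRe_apply, thetaForm_apply]

/-- The coframe `(dz, du / (u V) + i θ)`. -/
noncomputable def coframe (v : ℝ → ℝ) (p : ModelSpace n) : ModelSpace n →L[ℝ] ModelSpace n :=
  (ContinuousLinearMap.fst ℝ _ _).prod (verticalForm v p)

theorem coframe_apply (v : ℝ → ℝ) (p X : ModelSpace n) :
    coframe v p X = (X.1, verticalForm v p X) := rfl

/-- The frame inverse to `coframe`. -/
noncomputable def frame (v : ℝ → ℝ) (p : ModelSpace n) : ModelSpace n →L[ℝ] ModelSpace n :=
  (ContinuousLinearMap.fst ℝ _ _).prod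
    ((v (‖p.2‖ ^ 2) • (Complex.reCLM ∘L ContinuousLinearMap.snd ℝ _ _)).smulRight p.2
      + (Complex.imCLM ∘L ContinuousLinearMap.snd ℝ _ _ - (1 - ‖p.1‖ ^ 2)⁻¹ •
          (hermIm p.1 ∘L ContinuousLinearMap.fst ℝ _ _)).smulRight (Complex.I * p.2))

theorem frame_apply (v : ℝ → ℝ) (p a : ModelSpace n) :
    frame v p a = (a.1, (((v (‖p.2‖ ^ 2) * a.2.re : ℝ) : ℂ)
      + ((a.2.im - (1 - ‖p.1‖ ^ 2)⁻¹ * (inner ℂ p.1 a.1).im : ℝ) : ℂ) * Complex.I) * p.2) := by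
  refine Prod.ext rfl ?_
  simp [frame, hermIm_apply]
  ring

theorem coframe_frame {v : ℝ → ℝ} {p : ModelSpace n} (hw : p.2 ≠ 0) (hv : v (‖p.2‖ ^ 2) ≠ 0)
    (a : ModelSpace n) : coframe v p (frame v p a) = a := by
  have hs : ‖p.2‖ ^ 2 ≠ 0 := by positivity
  refine Prod.ext rfl ?_
  have key : ∀ c : ℂ, inner ℂ p.2 (c * p.2) = ((‖p.2‖ ^ 2 : ℝ) : ℂ) * c := by
    intro c
    rw [Complex.sq_norm, Complex.normSq_eq_conj_mul_self]
    simp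
    ring
  rw [coframe_apply, verticalForm_apply, frame_apply, key, Complex.re_ofReal_mul,
    Complex.im_ofReal_mul]
  apply Complex.ext <;>
    simp only [Complex.mul_re, Complex.add_re, Complex.add_im, Complex.ofReal_re, Complex.ofReal_im,
      Complex.I_re, Complex.I_im, Complex.mul_im] <;>
    field_simp <;> ring

theorem frame_coframe {v : ℝ → ℝ} {p : ModelSpace n} (hw : p.2 ≠ 0) (hv : v (‖p.2‖ ^ 2) ≠ 0)
    (X : ModelSpace n) : frame v p (coframe v p X) = X := by
  -- In finite dimension a one-sided inverse is two-sided.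
  have h1 : (frame v p).toLinearMap ∘ₗ (coframe v p).toLinearMap = LinearMap.id :=
    mul_eq_one_comm.1 (LinearMap.ext fun a => coframe_frame hw hv a)
  exact LinearMap.congr_fun h1 X

/-- The Hermitian form of the metric in the frame. -/
noncomputable def frameForm (v : ℝ → ℝ) (p a b : ModelSpace n) : ℂ :=
  (‖p.2‖ ^ 2 : ℝ) * ballForm p.1 a.1 b.1
    + ((‖p.2‖ ^ 2 * v (‖p.2‖ ^ 2) : ℝ) : ℂ) * (conj a.2 * b.2)

theorem warpedMetric_eq_frameForm {v : ℝ → ℝ} {p : ModelSpace n} (hw : p.2 ≠ 0)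
    (hv : v (‖p.2‖ ^ 2) ≠ 0) (X Y : ModelSpace n) :
    warpedMetric n (fun u => v (u ^ 2)) p X Y
      = (frameForm v p (coframe v p X) (coframe v p Y)).re := by
  have hs : ‖p.2‖ ≠ 0 := by positivity
  rw [warpedMetric_apply, frameForm, Complex.add_re, Complex.re_ofReal_mul, Complex.re_ofReal_mul,
    re_ballForm, coframe_apply, coframe_apply, verticalForm_apply, verticalForm_apply,
    duForm_apply, duForm_apply, thetaForm_apply, thetaForm_apply]
  simp only [map_add, map_mul, Complex.conj_ofReal, Complex.conj_I, Complex.mul_re, Complex.add_re,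
    Complex.add_im, Complex.ofReal_re, Complex.ofReal_im, Complex.I_re, Complex.I_im,
    Complex.mul_im, Complex.neg_re, Complex.neg_im]
  field_simp
  ring

/-- The connection form of the Levi-Civita connection in the frame. -/
noncomputable def connectionForm (v v₁ : ℝ → ℝ) (p X : ModelSpace n) :
    ModelSpace n →L[ℝ] ModelSpace n :=
  LinearMap.toContinuousLinearMap
    { toFun := fun a => (ballChristoffel p.1 X.1 a.1
        + ((v (‖p.2‖ ^ 2) : ℝ) : ℂ) • (verticalForm v p X • a.1 + a.2 • X.1),
        ((v (‖p.2‖ ^ 2) + ‖p.2‖ ^ 2 * v₁ (‖p.2‖ ^ 2) : ℝ) : ℂ) * (verticalForm v p X * a.2)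
          - ballForm p.1 X.1 a.1)
      map_add' := fun a b => by
        refine Prod.ext ?_ ?_
        · simp only [Prod.fst_add, Prod.snd_add, ballChristoffel_add]
          module
        · simp only [Prod.fst_add, Prod.snd_add, ballForm_add_right]
          ring
      map_smul' := fun r a => by
        refine Prod.ext ?_ ?_
        · simp only [Prod.smul_fst, Prod.smul_snd, RingHom.id_apply]
          rw [← algebraMap_smul ℂ r a.1, ← algebraMap_smul ℂ r a.2, ballChristoffel_smul]
          rw [← algebraMap_smul ℂ r (_ + _ : EuclideanSpace ℂ (Fin (n - 1)))]
          simp only [smul_eq_mul]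
          module
        · simp only [Prod.smul_fst, Prod.smul_snd, RingHom.id_apply]
          rw [← algebraMap_smul ℂ r a.1, ← algebraMap_smul ℂ r a.2, ballForm_smul_right,
            ← algebraMap_smul ℂ r (_ - _ : ℂ)]
          simp only [smul_eq_mul]
          ring }

theorem connectionForm_apply (v v₁ : ℝ → ℝ) (p X a : ModelSpace n) :
    connectionForm v v₁ p X a = (ballChristoffel p.1 X.1 a.1
        + ((v (‖p.2‖ ^ 2) : ℝ) : ℂ) • (verticalForm v p X • a.1 + a.2 • X.1),
        ((v (‖p.2‖ ^ 2) + ‖p.2‖ ^ 2 * v₁ (‖p.2‖ ^ 2) : ℝ) : ℂ) * (verticalForm v p X * a.2)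
          - ballForm p.1 X.1 a.1) := rfl

end Model

/-! ### First derivatives of the frame data along curves. -/

section Derivatives

open ComplexConjugate

variable {n : ℕ} {v v₁ v₂ : ℝ → ℝ} {s₀ : ℝ} {q : ℝ → ModelSpace n} {X : ModelSpace n} {t : ℝ}

theorem IsWarpingProfile.norm_sq_pos (hv : IsWarpingProfile v v₁ v₂ s₀) {p : ModelSpace n}
    (hp : p ∈ profileDomain n s₀) : 0 < ‖p.2‖ ^ 2 := hv.nonneg.trans_lt hp.2

theorem IsWarpingProfile.snd_ne_zero (hv : IsWarpingProfile v v₁ v₂ s₀) {p : ModelSpace n}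
    (hp : p ∈ profileDomain n s₀) : p.2 ≠ 0 := fun h => by
  simpa [h] using hv.norm_sq_pos hp

theorem hasDerivAt_fst_curve (hq : HasDerivAt q X t) : HasDerivAt (fun τ => (q τ).1) X.1 t :=
  (hasFDerivAt_fst (𝕜 := ℝ) (p := q t)).comp_hasDerivAt t hq

theorem hasDerivAt_snd_curve (hq : HasDerivAt q X t) : HasDerivAt (fun τ => (q τ).2) X.2 t :=
  (hasFDerivAt_snd (𝕜 := ℝ) (p := q t)).comp_hasDerivAt t hq

theorem hasDerivAt_norm_sq_snd (hq : HasDerivAt q X t) :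
    HasDerivAt (fun τ => ‖(q τ).2‖ ^ 2) (2 * (inner ℂ (q t).2 X.2).re) t := by
  have h := (hasFDerivAt_norm_sq_hermRe (q t).2).comp_hasDerivAt t (hasDerivAt_snd_curve hq)
  exact h

theorem HasDerivAt.complex_re {f : ℝ → ℂ} {c : ℂ} (h : HasDerivAt f c t) :
    HasDerivAt (fun τ => (f τ).re) c.re t :=
  Complex.reCLM.hasFDerivAt.comp_hasDerivAt t h

theorem HasDerivAt.complex_im {f : ℝ → ℂ} {c : ℂ} (h : HasDerivAt f c t) :
    HasDerivAt (fun τ => (f τ).im) c.im t :=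
  Complex.imCLM.hasFDerivAt.comp_hasDerivAt t h

/-- The derivative of `verticalForm v p Y` in the direction `X`. -/
noncomputable def verticalFormDeriv (v v₁ : ℝ → ℝ) (p X Y : ModelSpace n) : ℂ :=
  (((‖p.2‖ ^ 2 * v (‖p.2‖ ^ 2))⁻¹ * (inner ℂ X.2 Y.2).re
      - (‖p.2‖ ^ 2 * v (‖p.2‖ ^ 2))⁻¹ ^ 2 * (v (‖p.2‖ ^ 2) + ‖p.2‖ ^ 2 * v₁ (‖p.2‖ ^ 2))
        * (2 * (inner ℂ p.2 X.2).re) * (inner ℂ p.2 Y.2).re : ℝ) : ℂ)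
  + (((‖p.2‖ ^ 2)⁻¹ * (inner ℂ X.2 Y.2).im
      - (‖p.2‖ ^ 2)⁻¹ ^ 2 * (2 * (inner ℂ p.2 X.2).re) * (inner ℂ p.2 Y.2).im
      + ((1 - ‖p.1‖ ^ 2)⁻¹ * (inner ℂ X.1 Y.1).im
        + (1 - ‖p.1‖ ^ 2)⁻¹ ^ 2 * (2 * (inner ℂ p.1 X.1).re) * (inner ℂ p.1 Y.1).im) : ℝ) : ℂ)
    * Complex.I

/-- The exterior derivative of the vertical form is the curvature of the circle bundle. -/
theorem verticalFormDeriv_sub {p : ModelSpace n} (hw : p.2 ≠ 0) (X Y : ModelSpace n) :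
    verticalFormDeriv v v₁ p X Y - verticalFormDeriv v v₁ p Y X
      = ballForm p.1 X.1 Y.1 - ballForm p.1 Y.1 X.1 := by
  have hs : ‖p.2‖ ^ 2 ≠ 0 := by positivity
  have hs' : ‖p.2‖ ^ 2 = p.2.re * p.2.re + p.2.im * p.2.im := by
    rw [Complex.sq_norm, Complex.normSq_apply]
  have hre : (inner ℂ Y.2 X.2).re = (inner ℂ X.2 Y.2).re := by
    rw [← inner_conj_symm, Complex.conj_re]
  have him : (inner ℂ Y.2 X.2).im = -(inner ℂ X.2 Y.2).im := by
    rw [← inner_conj_symm, Complex.conj_im]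
  -- Valid because ℂ is one-dimensional over itself; this identity expresses that d(arg w) is
  -- closed, so only the ball term survives in dζ.
  have h1 : (inner ℂ X.2 Y.2).im * ‖p.2‖ ^ 2
      = (inner ℂ p.2 X.2).re * (inner ℂ p.2 Y.2).im
        - (inner ℂ p.2 Y.2).re * (inner ℂ p.2 X.2).im := by
    rw [hs']
    simp
    ring
  have h2 : (inner ℂ X.2 Y.2).im = ((inner ℂ p.2 X.2).re * (inner ℂ p.2 Y.2).im
        - (inner ℂ p.2 Y.2).re * (inner ℂ p.2 X.2).im) / ‖p.2‖ ^ 2 := by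
    rw [eq_div_iff hs, h1]
  rw [verticalFormDeriv, verticalFormDeriv, ballForm, ballForm, hre, him, h2,
    ← inner_conj_symm Y.1 X.1]
  generalize inner ℂ p.2 X.2 = a at *
  generalize inner ℂ p.2 Y.2 = b at *
  generalize inner ℂ X.2 Y.2 = c at *
  generalize inner ℂ p.1 X.1 = d at *
  generalize inner ℂ p.1 Y.1 = e at *
  generalize inner ℂ X.1 Y.1 = f at *
  generalize (1 - ‖p.1‖ ^ 2)⁻¹ = i
  generalize (‖p.2‖ ^ 2 * v (‖p.2‖ ^ 2))⁻¹ = k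
  generalize ‖p.2‖ ^ 2 = s at *
  apply Complex.ext
  · simp only [pow_two, Complex.sub_re, Complex.mul_re, Complex.add_re,
      Complex.ofReal_re, Complex.ofReal_im, Complex.I_re, Complex.I_im, Complex.mul_im,
      Complex.conj_re, Complex.conj_im]
    ring
  · simp only [pow_two, Complex.sub_im, Complex.mul_re, Complex.add_im,
      Complex.ofReal_re, Complex.ofReal_im, Complex.I_re, Complex.I_im, Complex.mul_im,
      Complex.conj_re, Complex.conj_im]
    field_simp
    ring

/-- The left side is ds for s = ‖w‖². Writing it through ζ and its conjugate makes the derivatives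
of all coefficients polynomial in frame components. -/
theorem IsWarpingProfile.two_mul_re_inner (hv : IsWarpingProfile v v₁ v₂ s₀) {p : ModelSpace n}
    (hp : p ∈ profileDomain n s₀) (X : ModelSpace n) :
    ((2 * (inner ℂ p.2 X.2).re : ℝ) : ℂ) = ((‖p.2‖ ^ 2 * v (‖p.2‖ ^ 2) : ℝ) : ℂ)
      * (verticalForm v p X + conj (verticalForm v p X)) := by
  have h1 := hv.norm_sq_pos hp
  have h2 := hv.pos _ hp.2
  have h3 : (verticalForm v p X).re = (‖p.2‖ ^ 2 * v (‖p.2‖ ^ 2))⁻¹ * (inner ℂ p.2 X.2).re := by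
    rw [verticalForm_apply, Complex.add_re, Complex.ofReal_re, Complex.re_ofReal_mul,
      Complex.I_re, mul_zero, add_zero]
  rw [Complex.add_conj, ← Complex.ofReal_mul, h3]
  rw [← mul_assoc, mul_comm _ (2 : ℝ), mul_assoc, mul_inv_cancel_left₀ (mul_pos h1 h2).ne']

theorem IsWarpingProfile.hasDerivAt_norm_sq (hv : IsWarpingProfile v v₁ v₂ s₀)
    (hq : HasDerivAt q X t) (hqt : q t ∈ profileDomain n s₀) :
    HasDerivAt (fun τ => ((‖(q τ).2‖ ^ 2 : ℝ) : ℂ))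
      (((‖(q t).2‖ ^ 2 * v (‖(q t).2‖ ^ 2) : ℝ) : ℂ)
        * (verticalForm v (q t) X + conj (verticalForm v (q t) X))) t :=
  (hasDerivAt_norm_sq_snd hq).ofReal_comp.congr_deriv (hv.two_mul_re_inner hqt X)

theorem IsWarpingProfile.hasDerivAt_profile (hv : IsWarpingProfile v v₁ v₂ s₀)
    (hq : HasDerivAt q X t) (hqt : q t ∈ profileDomain n s₀) :
    HasDerivAt (fun τ => ((v (‖(q τ).2‖ ^ 2) : ℝ) : ℂ))
      ((v₁ (‖(q t).2‖ ^ 2) : ℝ) * (((‖(q t).2‖ ^ 2 * v (‖(q t).2‖ ^ 2) : ℝ) : ℂ)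
        * (verticalForm v (q t) X + conj (verticalForm v (q t) X)))) t := by
  have h := ((hv.hasDerivAt _ hqt.2).comp t (hasDerivAt_norm_sq_snd hq)).ofReal_comp
  refine h.congr_deriv ?_
  rw [Complex.ofReal_mul, hv.two_mul_re_inner hqt X]

theorem IsWarpingProfile.hasDerivAt_profile_deriv (hv : IsWarpingProfile v v₁ v₂ s₀)
    (hq : HasDerivAt q X t) (hqt : q t ∈ profileDomain n s₀) :
    HasDerivAt (fun τ => ((v₁ (‖(q τ).2‖ ^ 2) : ℝ) : ℂ))
      ((v₂ (‖(q t).2‖ ^ 2) : ℝ) * (((‖(q t).2‖ ^ 2 * v (‖(q t).2‖ ^ 2) : ℝ) : ℂ)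
        * (verticalForm v (q t) X + conj (verticalForm v (q t) X)))) t := by
  have h := ((hv.hasDerivAt_deriv _ hqt.2).comp t (hasDerivAt_norm_sq_snd hq)).ofReal_comp
  refine h.congr_deriv ?_
  rw [Complex.ofReal_mul, hv.two_mul_re_inner hqt X]

theorem IsWarpingProfile.hasDerivAt_verticalForm (hv : IsWarpingProfile v v₁ v₂ s₀)
    (hq : HasDerivAt q X t) (hqt : q t ∈ profileDomain n s₀) (Y : ModelSpace n) :
    HasDerivAt (fun τ => verticalForm v (q τ) Y) (verticalFormDeriv v v₁ (q t) X Y) t := by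
  have hs := hasDerivAt_norm_sq_snd hq
  have hs0 := (hv.norm_sq_pos hqt).ne'
  have hP := hs.mul ((hv.hasDerivAt _ hqt.2).comp t hs)
  have hP0 := (mul_pos (hv.norm_sq_pos hqt) (hv.pos _ hqt.2)).ne'
  have hz := hasDerivAt_inner_const (hasDerivAt_fst_curve hq) Y.1
  have hw := hasDerivAt_inner_const (hasDerivAt_snd_curve hq) Y.2
  have hi := hasDerivAt_inv_one_sub_norm_sq (hasDerivAt_fst_curve hq) hqt.1
  have h1 := ((hP.inv hP0).mul hw.complex_re).ofReal_comp
  have h2 := (((hs.inv hs0).mul hw.complex_im).add (hi.mul hz.complex_im)).ofReal_comp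
  have h3 := h1.add (h2.mul_const Complex.I)
  refine (h3.congr_of_eventuallyEq (.of_forall fun τ => ?_)).congr_deriv ?_
  · simp only [verticalForm_apply]
    rfl
  · simp only [verticalFormDeriv, Pi.mul_apply, Pi.inv_apply, Function.comp_apply]
    refine congrArg₂ (· + ·) (congrArg _ ?_) (congrArg (fun r : ℝ => (r : ℂ) * Complex.I) ?_) <;>
      ring

/-- The covariant derivative of the constant field `Y` in the direction `X`, in the frame. -/
noncomputable def frameCovariantDeriv (v v₁ : ℝ → ℝ) (p X Y : ModelSpace n) : ModelSpace n :=
  (0, verticalFormDeriv v v₁ p X Y) + connectionForm v v₁ p X (coframe v p Y)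

/-- Vanishing torsion: the term `- ballForm` in the connection form is there to absorb dζ, and the
remaining terms are symmetric. -/
theorem frameCovariantDeriv_comm {p : ModelSpace n} (hw : p.2 ≠ 0) (X Y : ModelSpace n) :
    frameCovariantDeriv v v₁ p X Y = frameCovariantDeriv v v₁ p Y X := by
  have h := verticalFormDeriv_sub (v := v) (v₁ := v₁) hw X Y
  simp only [frameCovariantDeriv, connectionForm_apply, coframe_apply]
  refine Prod.ext ?_ ?_
  · simp only [Prod.fst_add]
    rw [ballChristoffel_comm, add_comm (verticalForm v p X • Y.1)]
  · simp only [Prod.snd_add]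
    linear_combination h

/-- Metric compatibility, proved for the full Hermitian form and not only for its real part. -/
theorem IsWarpingProfile.hasDerivAt_frameForm (hv : IsWarpingProfile v v₁ v₂ s₀)
    (hq : HasDerivAt q X t) (hqt : q t ∈ profileDomain n s₀) (Y Z : ModelSpace n) :
    HasDerivAt (fun τ => frameForm v (q τ) (coframe v (q τ) Y) (coframe v (q τ) Z))
      (frameForm v (q t) (frameCovariantDeriv v v₁ (q t) X Y) (coframe v (q t) Z)
        + frameForm v (q t) (coframe v (q t) Y) (frameCovariantDeriv v v₁ (q t) X Z)) t := by
  have hs := hv.hasDerivAt_norm_sq hq hqt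
  have hP := hs.mul (hv.hasDerivAt_profile hq hqt)
  have hb := hasDerivAt_ballForm (hasDerivAt_fst_curve hq) hqt.1 Y.1 Z.1
  have hY := hv.hasDerivAt_verticalForm hq hqt Y
  have hYc : HasDerivAt (fun τ => conj (verticalForm v (q τ) Y))
      (conj (verticalFormDeriv v v₁ (q t) X Y)) t := hY.star
  have hZ := hv.hasDerivAt_verticalForm hq hqt Z
  have h := (hs.mul hb).add (hP.mul (hYc.mul hZ))
  refine (h.congr_of_eventuallyEq (.of_forall fun τ => ?_)).congr_deriv ?_
  · simp only [frameForm, coframe_apply, Complex.ofReal_mul]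
    rfl
  · simp only [frameForm, frameCovariantDeriv, connectionForm_apply, coframe_apply, Pi.mul_apply,
      Prod.fst_add, Prod.snd_add, zero_add, ballForm_add_left, ballForm_add_right,
      ballForm_smul_left, ballForm_smul_right, map_add, map_sub, map_mul, Complex.conj_ofReal,
      conj_ballForm, Complex.ofReal_mul, Complex.ofReal_add]
    ring

/-- The derivative of `connectionForm v v₁ p Y a` in the direction `X`. -/
noncomputable def connectionFormDeriv (v v₁ v₂ : ℝ → ℝ) (p X Y a : ModelSpace n) : ModelSpace n :=
  let s : ℝ := ‖p.2‖ ^ 2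
  let δ : ℂ := (s * v s : ℝ) * (verticalForm v p X + conj (verticalForm v p X))
  (ballChristoffelDeriv p.1 X.1 Y.1 a.1
      + ((v₁ s : ℂ) * δ) • (verticalForm v p Y • a.1 + a.2 • Y.1)
      + ((v s : ℂ) * verticalFormDeriv v v₁ p X Y) • a.1,
    (2 * v₁ s + s * v₂ s : ℂ) * δ * (verticalForm v p Y * a.2)
      + (v s + s * v₁ s : ℂ) * (verticalFormDeriv v v₁ p X Y * a.2)
      - (ballForm p.1 (ballChristoffel p.1 X.1 Y.1) a.1
        + ballForm p.1 Y.1 (ballChristoffel p.1 X.1 a.1)))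

theorem IsWarpingProfile.hasDerivAt_connectionForm (hv : IsWarpingProfile v v₁ v₂ s₀)
    (hq : HasDerivAt q X t) (hqt : q t ∈ profileDomain n s₀) (Y a : ModelSpace n) :
    HasDerivAt (fun τ => connectionForm v v₁ (q τ) Y a)
      (connectionFormDeriv v v₁ v₂ (q t) X Y a) t := by
  have hs := hv.hasDerivAt_norm_sq hq hqt
  have hv0 := hv.hasDerivAt_profile hq hqt
  have hv1 := hv.hasDerivAt_profile_deriv hq hqt
  have hY := hv.hasDerivAt_verticalForm hq hqt Y
  have hb := hasDerivAt_ballForm (hasDerivAt_fst_curve hq) hqt.1 Y.1 a.1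
  have hc := hasDerivAt_ballChristoffel (hasDerivAt_fst_curve hq) hqt.1 Y.1 a.1
  have h1 := hc.add (hv0.smul ((hY.smul_const a.1).add (hasDerivAt_const t (a.2 • Y.1))))
  have h2 := ((hv0.add (hs.mul hv1)).mul (hY.mul_const a.2)).sub hb
  refine ((h1.prodMk h2).congr_of_eventuallyEq (.of_forall fun τ => ?_)).congr_deriv ?_
  · simp only [connectionForm_apply, Complex.ofReal_mul, Complex.ofReal_add]
    rfl
  · simp only [connectionFormDeriv, Pi.mul_apply, Pi.add_apply, Complex.ofReal_mul]
    refine Prod.ext ?_ ?_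
    · dsimp only
      module
    · dsimp only
      ring

end Derivatives

/-! ### Smoothness, positivity and the curvature for a general profile. -/

section Curvature

open ComplexConjugate

variable {n : ℕ} {v v₁ v₂ : ℝ → ℝ} {s₀ : ℝ}

theorem isOpen_profileDomain (n : ℕ) (s₀ : ℝ) : IsOpen (profileDomain n s₀) :=
  (isOpen_lt continuous_fst.norm continuous_const).inter
    (isOpen_lt continuous_const (continuous_snd.norm.pow 2))

theorem contDiff_norm_sq_snd : ContDiff ℝ ∞ (fun p : ModelSpace n => ‖p.2‖ ^ 2) :=
  contDiff_snd.norm_sq ℂ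

theorem contDiffOn_inv_one_sub_norm_sq :
    ContDiffOn ℝ ∞ (fun p : ModelSpace n => (1 - ‖p.1‖ ^ 2)⁻¹) (profileDomain n s₀) := by
  refine ContDiffOn.inv ?_ fun p hp => ?_
  · exact (contDiff_const.sub (contDiff_fst.norm_sq ℂ)).contDiffOn
  · nlinarith [norm_nonneg p.1, hp.1]

theorem contDiff_inner_fst (y : EuclideanSpace ℂ (Fin (n - 1))) :
    ContDiff ℝ ∞ (fun p : ModelSpace n => inner ℂ p.1 y) :=
  contDiff_fst.inner ℂ contDiff_const

theorem contDiff_inner_snd (y : ℂ) : ContDiff ℝ ∞ (fun p : ModelSpace n => inner ℂ p.2 y) :=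
  contDiff_snd.inner ℂ contDiff_const

theorem ContDiffOn.complex_ofReal {E : Type*} [NormedAddCommGroup E] [NormedSpace ℝ E]
    {f : E → ℝ} {U : Set E} (hf : ContDiffOn ℝ ∞ f U) :
    ContDiffOn ℝ ∞ (fun p => ((f p : ℝ) : ℂ)) U :=
  Complex.ofRealCLM.contDiff.comp_contDiffOn hf

theorem ContDiffOn.complex_conj {E : Type*} [NormedAddCommGroup E] [NormedSpace ℝ E]
    {f : E → ℂ} {U : Set E} (hf : ContDiffOn ℝ ∞ f U) :
    ContDiffOn ℝ ∞ (fun p => conj (f p)) U :=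
  Complex.conjCLE.contDiff.comp_contDiffOn hf

theorem IsWarpingProfile.contDiffOn_profile (hv : IsWarpingProfile v v₁ v₂ s₀) :
    ContDiffOn ℝ ∞ (fun p : ModelSpace n => v (‖p.2‖ ^ 2)) (profileDomain n s₀) :=
  hv.contDiffOn.comp contDiff_norm_sq_snd.contDiffOn fun _ hp => hp.2

theorem IsWarpingProfile.contDiffOn_profile_deriv (hv : IsWarpingProfile v v₁ v₂ s₀) :
    ContDiffOn ℝ ∞ (fun p : ModelSpace n => v₁ (‖p.2‖ ^ 2)) (profileDomain n s₀) :=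
  hv.contDiffOn_deriv.comp contDiff_norm_sq_snd.contDiffOn fun _ hp => hp.2

theorem IsWarpingProfile.contDiffOn_verticalForm (hv : IsWarpingProfile v v₁ v₂ s₀)
    (X : ModelSpace n) :
    ContDiffOn ℝ ∞ (fun p : ModelSpace n => verticalForm v p X) (profileDomain n s₀) := by
  have hs : ContDiffOn ℝ ∞ (fun p : ModelSpace n => ‖p.2‖ ^ 2) (profileDomain n s₀) :=
    contDiff_norm_sq_snd.contDiffOn
  have hw := (contDiff_inner_snd (n := n) X.2).contDiffOn (s := profileDomain n s₀)
  have hz := (contDiff_inner_fst (n := n) X.1).contDiffOn (s := profileDomain n s₀)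
  have h1 := ((hs.mul hv.contDiffOn_profile).inv fun p hp =>
    (mul_pos (hv.norm_sq_pos hp) (hv.pos _ hp.2)).ne').mul
      (Complex.reCLM.contDiff.comp_contDiffOn hw)
  have h2 := ((hs.inv fun p hp => (hv.norm_sq_pos hp).ne').mul
    (Complex.imCLM.contDiff.comp_contDiffOn hw)).add
      (contDiffOn_inv_one_sub_norm_sq.mul (Complex.imCLM.contDiff.comp_contDiffOn hz))
  refine (h1.complex_ofReal.add (h2.complex_ofReal.mul (contDiffOn_const (c := Complex.I)))).congr fun p _ => ?_
  rw [verticalForm_apply]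
  rfl

theorem IsWarpingProfile.contDiffOn_coframe (hv : IsWarpingProfile v v₁ v₂ s₀) :
    ContDiffOn ℝ ∞ (coframe v : ModelSpace n → _) (profileDomain n s₀) :=
  contDiffOn_clm_apply.2 fun X => contDiffOn_const.prodMk (hv.contDiffOn_verticalForm X)

theorem contDiffOn_ballForm (x y : EuclideanSpace ℂ (Fin (n - 1))) :
    ContDiffOn ℝ ∞ (fun p : ModelSpace n => ballForm p.1 x y) (profileDomain n s₀) := by
  have hi := (contDiffOn_inv_one_sub_norm_sq (n := n) (s₀ := s₀)).complex_ofReal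
  exact (hi.mul contDiffOn_const).add ((hi.pow 2).mul
    ((contDiff_inner_fst x).contDiffOn.complex_conj.mul (contDiff_inner_fst y).contDiffOn))

theorem contDiffOn_ballChristoffel (x y : EuclideanSpace ℂ (Fin (n - 1))) :
    ContDiffOn ℝ ∞ (fun p : ModelSpace n => ballChristoffel p.1 x y) (profileDomain n s₀) := by
  have hi := (contDiffOn_inv_one_sub_norm_sq (n := n) (s₀ := s₀)).complex_ofReal
  exact hi.smul (((contDiff_inner_fst x).contDiffOn.smul contDiffOn_const).add
    ((contDiff_inner_fst y).contDiffOn.smul contDiffOn_const))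

theorem IsWarpingProfile.contDiffOn_frame (hv : IsWarpingProfile v v₁ v₂ s₀) :
    ContDiffOn ℝ ∞ (frame v : ModelSpace n → _) (profileDomain n s₀) := by
  refine contDiffOn_clm_apply.2 fun a => ?_
  have hz := (contDiff_inner_fst (n := n) a.1).contDiffOn (s := profileDomain n s₀)
  have h1 := (hv.contDiffOn_profile (n := n)).mul (contDiffOn_const (c := a.2.re))
  have h2 := (contDiffOn_const (c := a.2.im)).sub
    (contDiffOn_inv_one_sub_norm_sq.mul (Complex.imCLM.contDiff.comp_contDiffOn hz))
  refine ((contDiffOn_const (c := a.1)).prodMk ((h1.complex_ofReal.add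
    (h2.complex_ofReal.mul (contDiffOn_const (c := Complex.I)))).mul contDiff_snd.contDiffOn)).congr fun p _ => ?_
  rw [frame_apply]
  rfl

theorem IsWarpingProfile.contDiffOn_connectionForm (hv : IsWarpingProfile v v₁ v₂ s₀)
    (X : ModelSpace n) :
    ContDiffOn ℝ ∞ (fun p => connectionForm v v₁ p X) (profileDomain n s₀) := by
  refine contDiffOn_clm_apply.2 fun a => ?_
  have hv0 := hv.contDiffOn_profile (n := n)
  have hs : ContDiffOn ℝ ∞ (fun p : ModelSpace n => ‖p.2‖ ^ 2) (profileDomain n s₀) :=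
    contDiff_norm_sq_snd.contDiffOn
  have hX := hv.contDiffOn_verticalForm X
  exact ((contDiffOn_ballChristoffel X.1 a.1).add
    (hv0.complex_ofReal.smul ((hX.smul contDiffOn_const).add contDiffOn_const))).prodMk
      (((hv0.add (hs.mul hv.contDiffOn_profile_deriv)).complex_ofReal.mul
        (hX.mul contDiffOn_const)).sub (contDiffOn_ballForm X.1 a.1))

theorem IsWarpingProfile.warpedMetric_eq (hv : IsWarpingProfile v v₁ v₂ s₀) {p : ModelSpace n}
    (hp : p ∈ profileDomain n s₀) (X Y : ModelSpace n) :
    warpedMetric n (fun u => v (u ^ 2)) p X Y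
      = (frameForm v p (coframe v p X) (coframe v p Y)).re :=
  warpedMetric_eq_frameForm (hv.snd_ne_zero hp) (hv.pos _ hp.2).ne' X Y

theorem IsWarpingProfile.contDiffOn_warpedMetric (hv : IsWarpingProfile v v₁ v₂ s₀) :
    ContDiffOn ℝ ∞ (warpedMetric n (fun u => v (u ^ 2))) (profileDomain n s₀) := by
  refine contDiffOn_clm_apply.2 fun X => contDiffOn_clm_apply.2 fun Y => ?_
  have hs : ContDiffOn ℝ ∞ (fun p : ModelSpace n => ‖p.2‖ ^ 2) (profileDomain n s₀) :=
    contDiff_norm_sq_snd.contDiffOn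
  have h := (hs.complex_ofReal.mul (contDiffOn_ballForm X.1 Y.1)).add
    ((hs.mul hv.contDiffOn_profile).complex_ofReal.mul
      ((hv.contDiffOn_verticalForm X).complex_conj.mul (hv.contDiffOn_verticalForm Y)))
  exact (Complex.reCLM.contDiff.comp_contDiffOn h).congr fun p hp => hv.warpedMetric_eq hp X Y

/-- An injective linear map under which `ballForm z` is the pullback of an inner product. -/
noncomputable def ballLift {H : Type*} [NormedAddCommGroup H] [InnerProductSpace ℂ H] (z x : H) :
    WithLp 2 (H × ℂ) :=
  WithLp.toLp 2 ((√((1 - ‖z‖ ^ 2)⁻¹) : ℂ) • x, ((1 - ‖z‖ ^ 2)⁻¹ : ℝ) * inner ℂ z x)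

theorem ballForm_eq_inner {H : Type*} [NormedAddCommGroup H] [InnerProductSpace ℂ H] {z : H}
    (hz : ‖z‖ < 1) (x y : H) : ballForm z x y = inner ℂ (ballLift z x) (ballLift z y) := by
  have hi : 0 ≤ (1 - ‖z‖ ^ 2)⁻¹ := by
    have : 0 < 1 - ‖z‖ ^ 2 := by nlinarith [norm_nonneg z]
    positivity
  have hsq : (((1 - ‖z‖ ^ 2)⁻¹ : ℝ) : ℂ)
      = ((√((1 - ‖z‖ ^ 2)⁻¹) : ℝ) : ℂ) * ((√((1 - ‖z‖ ^ 2)⁻¹) : ℝ) : ℂ) := by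
    rw [← Complex.ofReal_mul, Real.mul_self_sqrt hi]
  simp only [ballLift, WithLp.prod_inner_apply, inner_smul_left, inner_smul_right,
    Complex.conj_ofReal, ballForm, RCLike.inner_apply, map_mul]
  linear_combination inner ℂ x y * hsq

theorem ballForm_self_im {H : Type*} [NormedAddCommGroup H] [InnerProductSpace ℂ H] (z x : H) :
    (ballForm z x x).im = 0 :=
  Complex.conj_eq_iff_im.1 (conj_ballForm z x x)

theorem re_ballForm_self {H : Type*} [NormedAddCommGroup H] [InnerProductSpace ℂ H] {z : H}
    (hz : ‖z‖ < 1) (x : H) : (ballForm z x x).re = ‖ballLift z x‖ ^ 2 := by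
  rw [ballForm_eq_inner hz]
  exact (norm_sq_eq_re_inner (𝕜 := ℂ) (ballLift z x)).symm

theorem ballForm_self_nonneg {H : Type*} [NormedAddCommGroup H] [InnerProductSpace ℂ H] {z : H}
    (hz : ‖z‖ < 1) (x : H) : 0 ≤ (ballForm z x x).re := by
  rw [re_ballForm_self hz]
  positivity

theorem ballForm_self_pos {H : Type*} [NormedAddCommGroup H] [InnerProductSpace ℂ H] {z : H}
    (hz : ‖z‖ < 1) {x : H} (hx : x ≠ 0) : 0 < (ballForm z x x).re := by
  rw [re_ballForm_self hz]
  refine pow_pos (norm_pos_iff.2 fun h => hx ?_) 2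
  have hi : 0 < (1 - ‖z‖ ^ 2)⁻¹ := by
    have : 0 < 1 - ‖z‖ ^ 2 := by nlinarith [norm_nonneg z]
    positivity
  have h1 := congrArg Prod.fst (congrArg WithLp.ofLp h)
  refine (smul_eq_zero.1 h1).resolve_left ?_
  exact Complex.ofReal_ne_zero.2 (Real.sqrt_pos.2 hi).ne'

/-- The Hermitian version is required, since the imaginary part of `ballForm` enters the curvature
with weight 3. -/
theorem ballForm_cauchy_schwarz {H : Type*} [NormedAddCommGroup H] [InnerProductSpace ℂ H] {z : H}
    (hz : ‖z‖ < 1) (x y : H) :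
    (ballForm z x y).re ^ 2 + (ballForm z x y).im ^ 2
      ≤ (ballForm z x x).re * (ballForm z y y).re := by
  have h : (ballForm z x y).re ^ 2 + (ballForm z x y).im ^ 2 = ‖ballForm z x y‖ ^ 2 := by
    rw [Complex.sq_norm, Complex.normSq_apply]
    ring
  rw [h, ballForm_eq_inner hz, re_ballForm_self hz, re_ballForm_self hz, ← mul_pow]
  exact pow_le_pow_left₀ (norm_nonneg _) (norm_inner_le_norm _ _) 2

theorem IsWarpingProfile.isRiemannianMetricOn (hv : IsWarpingProfile v v₁ v₂ s₀) :
    IsRiemannianMetricOn (warpedMetric n (fun u => v (u ^ 2))) (profileDomain n s₀) where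
  isOpen := isOpen_profileDomain n s₀
  contDiffOn := hv.contDiffOn_warpedMetric
  symm p hp X Y := by
    rw [hv.warpedMetric_eq hp, hv.warpedMetric_eq hp, ← Complex.conj_re]
    simp only [frameForm, map_add, map_mul, Complex.conj_ofReal, conj_ballForm, Complex.conj_conj]
    rw [mul_comm (conj (coframe v p Y).2)]
  pos p hp X hX := by
    have hs := hv.norm_sq_pos hp
    have hP := mul_pos hs (hv.pos _ hp.2)
    rw [hv.warpedMetric_eq hp, frameForm, Complex.add_re, Complex.re_ofReal_mul,
      Complex.re_ofReal_mul, ← Complex.normSq_eq_conj_mul_self, Complex.ofReal_re]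
    by_cases h1 : (coframe v p X).1 = 0
    · have h2 : (coframe v p X).2 ≠ 0 := fun h2 => hX <| by
        rw [← frame_coframe (hv.snd_ne_zero hp) (hv.pos _ hp.2).ne' X,
          show coframe v p X = 0 from Prod.ext h1 h2, map_zero]
      have := ballForm_self_nonneg hp.1 (coframe v p X).1
      have := Complex.normSq_pos.2 h2
      positivity
    · have := ballForm_self_pos hp.1 h1
      have := Complex.normSq_nonneg (coframe v p X).2
      positivity

theorem IsWarpingProfile.fderiv_coframe (hv : IsWarpingProfile v v₁ v₂ s₀) {p : ModelSpace n}
    (hp : p ∈ profileDomain n s₀) (X Y : ModelSpace n) :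
    fderiv ℝ (coframe v) p X Y = (0, verticalFormDeriv v v₁ p X Y) := by
  have hd := (hv.contDiffOn_coframe.contDiffAt
    ((isOpen_profileDomain n s₀).mem_nhds hp)).differentiableAt (by simp)
  refine fderiv_clm_apply_eq_of_hasDerivAt_line hd ?_
  have h := hv.hasDerivAt_verticalForm (hasDerivAt_line p X 0) (by simpa using hp) Y
  simp only [zero_smul, add_zero] at h
  exact (hasDerivAt_const (0 : ℝ) Y.1).prodMk h

theorem IsWarpingProfile.fderiv_warpedMetric (hv : IsWarpingProfile v v₁ v₂ s₀) {p : ModelSpace n}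
    (hp : p ∈ profileDomain n s₀) (X Y Z : ModelSpace n) :
    fderiv ℝ (warpedMetric n (fun u => v (u ^ 2))) p X Y Z
      = (frameForm v p (frameCovariantDeriv v v₁ p X Y) (coframe v p Z)
        + frameForm v p (coframe v p Y) (frameCovariantDeriv v v₁ p X Z)).re := by
  have hU := (isOpen_profileDomain n s₀).mem_nhds hp
  have hd := (hv.contDiffOn_warpedMetric.contDiffAt hU).differentiableAt (by simp)
  have h1 := fderiv_clm_apply_eq_of_hasDerivAt_line
    (hd.clm_apply (differentiableAt_const Y)) (X := X) (Y := Z)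
    (c := (frameForm v p (frameCovariantDeriv v v₁ p X Y) (coframe v p Z)
        + frameForm v p (coframe v p Y) (frameCovariantDeriv v v₁ p X Z)).re) ?_
  · rw [← h1, fderiv_clm_apply hd (differentiableAt_const Y)]
    simp
  · have h := (hv.hasDerivAt_frameForm (hasDerivAt_line p X 0) (by simpa using hp) Y Z).complex_re
    simp only [zero_smul, add_zero] at h
    -- The frame expression of the metric is available only on the open domain, in which the line
    -- stays for small t.
    refine h.congr_of_eventuallyEq ?_
    have hc : Filter.Tendsto (fun t : ℝ => p + t • X) (nhds 0) (nhds p) := by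
      simpa using (hasDerivAt_line p X 0).continuousAt.tendsto
    filter_upwards [hc hU] with t ht using hv.warpedMetric_eq ht Y Z

theorem IsWarpingProfile.isLeviCivitaFrame (hv : IsWarpingProfile v v₁ v₂ s₀) :
    IsLeviCivitaFrame (warpedMetric n (fun u => v (u ^ 2))) (coframe v) (frame v)
      (connectionForm v v₁) (profileDomain n s₀) where
  isOpen := isOpen_profileDomain n s₀
  symm := hv.isRiemannianMetricOn.symm
  pos := hv.isRiemannianMetricOn.pos
  contDiffOn_coframe := hv.contDiffOn_coframe.of_le (by norm_cast)
  differentiableAt_frame p hp := (hv.contDiffOn_frame.contDiffAt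
    ((isOpen_profileDomain n s₀).mem_nhds hp)).differentiableAt (by simp)
  differentiableAt_connection p hp X := ((hv.contDiffOn_connectionForm X).contDiffAt
    ((isOpen_profileDomain n s₀).mem_nhds hp)).differentiableAt (by simp)
  coframe_frame p hp a := coframe_frame (hv.snd_ne_zero hp) (hv.pos _ hp.2).ne' a
  torsion p hp X Y := by
    rw [hv.fderiv_coframe hp, hv.fderiv_coframe hp]
    exact frameCovariantDeriv_comm (hv.snd_ne_zero hp) X Y
  metric p hp X Y Z := by
    rw [hv.fderiv_warpedMetric hp, hv.fderiv_coframe hp, hv.fderiv_coframe hp,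
      hv.warpedMetric_eq hp, hv.warpedMetric_eq hp,
      coframe_frame (hv.snd_ne_zero hp) (hv.pos _ hp.2).ne',
      coframe_frame (hv.snd_ne_zero hp) (hv.pos _ hp.2).ne', Complex.add_re]
    rfl

theorem IsWarpingProfile.fderiv_connectionForm (hv : IsWarpingProfile v v₁ v₂ s₀)
    {p : ModelSpace n} (hp : p ∈ profileDomain n s₀) (X Y a : ModelSpace n) :
    fderiv ℝ (fun p => connectionForm v v₁ p Y) p X a = connectionFormDeriv v v₁ v₂ p X Y a := by
  have hd := ((hv.contDiffOn_connectionForm Y).contDiffAt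
    ((isOpen_profileDomain n s₀).mem_nhds hp)).differentiableAt (by simp)
  refine fderiv_clm_apply_eq_of_hasDerivAt_line hd ?_
  have h := hv.hasDerivAt_connectionForm (hasDerivAt_line p X 0) (by simpa using hp) Y a
  simpa only [zero_smul, add_zero] using h

/-- The curvature form in the frame. -/
noncomputable def frameCurvature (v v₁ v₂ : ℝ → ℝ) (p a b c : ModelSpace n) : ModelSpace n :=
  let s : ℝ := ‖p.2‖ ^ 2
  let h := ballForm p.1
  ((1 + v s : ℂ) • ((h a.1 b.1 - h b.1 a.1) • c.1 + h a.1 c.1 • b.1 - h b.1 c.1 • a.1)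
      + (v₁ s * (s * v s) : ℂ) • ((conj a.2 * b.2 - conj b.2 * a.2) • c.1
        + c.2 • (conj a.2 • b.1 - conj b.2 • a.1)),
    ((2 * v₁ s + s * v₂ s) * (s * v s) * (conj a.2 * b.2 - conj b.2 * a.2)
      + s * v₁ s * (h a.1 b.1 - h b.1 a.1)) * c.2
      + s * v₁ s * (b.2 * h a.1 c.1 - a.2 * h b.1 c.1))

theorem IsWarpingProfile.coframe_riemannCurvature (hv : IsWarpingProfile v v₁ v₂ s₀)
    {p : ModelSpace n} (hp : p ∈ profileDomain n s₀) (X Y Z : ModelSpace n) :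
    coframe v p (riemannCurvature (warpedMetric n (fun u => v (u ^ 2))) p X Y Z)
      = frameCurvature v v₁ v₂ p (coframe v p X) (coframe v p Y) (coframe v p Z) := by
  rw [hv.isLeviCivitaFrame.coframe_riemannCurvature hp, hv.fderiv_connectionForm hp,
    hv.fderiv_connectionForm hp]
  have hd := verticalFormDeriv_sub (v := v) (v₁ := v₁) (hv.snd_ne_zero hp) X Y
  have hd' : verticalFormDeriv v v₁ p X Y = verticalFormDeriv v v₁ p Y X
      + (ballForm p.1 X.1 Y.1 - ballForm p.1 Y.1 X.1) := by linear_combination hd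
  have hb := ballChristoffel_curvature p.1 X.1 Y.1 (coframe v p Z).1
  -- Solves the curvature identity of the ball for one `ballChristoffelDeriv` term, so that
  -- rewriting eliminates it and a plain module identity is left.
  have hb' := eq_add_of_sub_eq (eq_sub_of_add_eq (eq_add_of_sub_eq hb))
  simp only [frameCurvature, connectionFormDeriv, connectionForm_apply, coframe_apply,
    Complex.ofReal_mul, Complex.ofReal_add] at hb' ⊢
  refine Prod.ext ?_ ?_
  · simp only [Prod.fst_add, Prod.fst_sub, ballChristoffel_add, ballChristoffel_smul]
    rw [hb', hd', ballChristoffel_comm p.1 Y.1 X.1]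
    module
  · simp only [Prod.snd_add, Prod.snd_sub, ballForm_add_right, ballForm_smul_right]
    rw [hd', ballChristoffel_comm p.1 Y.1 X.1]
    ring

/-- The three summands are the horizontal, mixed and vertical contributions. The coefficients 3 and
6 on the imaginary parts reflect the Kähler structure. -/
theorem IsWarpingProfile.warpedMetric_riemannCurvature (hv : IsWarpingProfile v v₁ v₂ s₀)
    {p : ModelSpace n} (hp : p ∈ profileDomain n s₀) (X Y : ModelSpace n) {s : ℝ}
    (hs : s = ‖p.2‖ ^ 2) {k m : ℂ} (hk : k = ballForm p.1 X.1 Y.1)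
    (hm : m = conj (verticalForm v p X) * verticalForm v p Y) :
    warpedMetric n (fun u => v (u ^ 2)) p
        (riemannCurvature (warpedMetric n (fun u => v (u ^ 2))) p X Y Y) X
      = -(s * (1 + v s) * ((ballForm p.1 X.1 X.1).re * (ballForm p.1 Y.1 Y.1).re
            - k.re ^ 2 + 3 * k.im ^ 2)
        + s * v₁ s * (s * v s) * ((ballForm p.1 X.1 X.1).re * Complex.normSq (verticalForm v p Y)
            + (ballForm p.1 Y.1 Y.1).re * Complex.normSq (verticalForm v p X)
            - 2 * k.re * m.re + 6 * k.im * m.im)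
        + 2 * (2 * v₁ s + s * v₂ s) * (s * v s) ^ 2 * m.im ^ 2) := by
  rw [hv.warpedMetric_eq hp, hv.coframe_riemannCurvature hp]
  have hX := ballForm_self_im p.1 X.1
  have hY := ballForm_self_im p.1 Y.1
  subst hs hm
  simp only [frameForm, frameCurvature, coframe_apply, ballForm_add_left, sub_eq_add_neg,
    ballForm_smul_left, ← neg_smul]
  rw [← conj_ballForm p.1 X.1 Y.1, ← hk]
  generalize ballForm p.1 X.1 X.1 = r at *
  generalize ballForm p.1 Y.1 Y.1 = r' at *
  generalize verticalForm v p X = a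
  generalize verticalForm v p Y = b
  generalize ‖p.2‖ ^ 2 = s
  generalize v s = v
  generalize v₁ s = v₁
  generalize v₂ s = v₂
  clear hk
  obtain ⟨r, ri⟩ := r
  obtain ⟨r', ri'⟩ := r'
  obtain ⟨a, a'⟩ := a
  obtain ⟨b, b'⟩ := b
  obtain ⟨k, k'⟩ := k
  simp only at hX hY
  subst hX hY
  simp [Complex.normSq_apply]
  ring

end Curvature

/-! ### Algebraic inequalities behind the curvature bounds. -/

section Bounds

open ComplexConjugate

variable {n : ℕ}

theorem gram_pos {E : Type*} [NormedAddCommGroup E] [NormedSpace ℝ E]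
    {g : E →L[ℝ] E →L[ℝ] ℝ} (hsymm : ∀ X Y, g X Y = g Y X) (hpos : ∀ X, X ≠ 0 → 0 < g X X)
    {X Y : E} (h : LinearIndependent ℝ ![X, Y]) : 0 < g X X * g Y Y - g X Y ^ 2 := by
  have hY : 0 < g Y Y := hpos Y (h.ne_zero 1)
  -- A multiple of the component of X orthogonal to Y; its squared length is g(Y,Y) times the Gram
  -- determinant.
  have hW : g Y Y • X + (-g X Y) • Y ≠ 0 := fun h0 =>
    hY.ne' (LinearIndependent.pair_iff.1 h _ _ h0).1
  have h1 := hpos _ hW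
  simp only [map_add, map_smul, add_apply, smul_apply, smul_eq_mul, hsymm Y X] at h1
  have h2 : 0 < g Y Y * (g X X * g Y Y - g X Y ^ 2) := by linarith
  exact (pos_iff_pos_of_mul_pos h2).1 hY

/-- Since ab = m² + m'², the right side minus the left is a sum of nonnegative terms: (1+N)τ(rr' -
k²) + 3(1-Nτ)(k'+m')² + 3(1+N)τk'² + 2N(N+1)τm'². -/
theorem curvature_upper_bound {N τ r r' a b k k' m m' : ℝ} (hN : 0 ≤ N) (hτ : 0 ≤ τ)
    (hNτ : N * τ ≤ 1) (hk : k ^ 2 + k' ^ 2 ≤ r * r') (hm : m ^ 2 + m' ^ 2 = a * b) :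
    (1 - N * τ) * ((r + a) * (r' + b) - (k + m) ^ 2)
      ≤ (1 + τ) * (r * r' - k ^ 2 + 3 * k' ^ 2)
        + (1 - N * τ) * (r * b + r' * a - 2 * k * m + 6 * k' * m')
        + (4 + 2 * N * (N - 1) * τ) * m' ^ 2 := by
  have h1 : 0 ≤ (1 + N) * τ * (r * r' - k ^ 2) :=
    mul_nonneg (by positivity) (by nlinarith [sq_nonneg k'])
  have h2 : 0 ≤ (1 - N * τ) * (k' + m') ^ 2 := mul_nonneg (by linarith) (sq_nonneg _)
  have h3 : 0 ≤ N * τ * (k' ^ 2 + m' ^ 2) := by positivity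
  have h4 : 0 ≤ τ * k' ^ 2 := by positivity
  have h5 : 0 ≤ N ^ 2 * τ * m' ^ 2 := by positivity
  have h6 : 0 ≤ N * τ * k' ^ 2 := by positivity
  have h7 : a * b = m ^ 2 + m' ^ 2 := hm.symm
  nlinarith [h1, h2, h3, h4, h5, h6, h7]

theorem two_mul_inner_le {r r' a b k k' m m' : ℝ} (hr : 0 ≤ r) (hr' : 0 ≤ r') (ha : 0 ≤ a)
    (hb : 0 ≤ b) (hk : k ^ 2 + k' ^ 2 ≤ r * r') (hm : m ^ 2 + m' ^ 2 = a * b) :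
    2 * (k * m + k' * m') ≤ r * b + r' * a := by
  refine le_of_sq_le_sq ?_ (by positivity)
  have h1 : (k * m + k' * m') ^ 2 ≤ (k ^ 2 + k' ^ 2) * (m ^ 2 + m' ^ 2) := by
    nlinarith [sq_nonneg (k * m' - k' * m)]
  have h2 : (k ^ 2 + k' ^ 2) * (m ^ 2 + m' ^ 2) ≤ r * r' * (a * b) := by
    rw [hm]
    exact mul_le_mul_of_nonneg_right hk (by positivity)
  nlinarith [sq_nonneg (r * b - r' * a)]

/-- After ab = m² + m'² the m'² terms cancel. The horizontal remainder is controlled by rr' ≥ k² +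
k'², and the mixed one by `two_mul_inner_le`. -/
theorem curvature_lower_bound {N τ r r' a b k k' m m' : ℝ} (hN : 2 ≤ N) (hτ : 0 ≤ τ)
    (hNτ : N * τ ≤ 1) (hr : 0 ≤ r) (hr' : 0 ≤ r') (ha : 0 ≤ a) (hb : 0 ≤ b)
    (hk : k ^ 2 + k' ^ 2 ≤ r * r') (hm : m ^ 2 + m' ^ 2 = a * b) :
    (1 + τ) * (r * r' - k ^ 2 + 3 * k' ^ 2)
        + (1 - N * τ) * (r * b + r' * a - 2 * k * m + 6 * k' * m')
        + (4 + 2 * N * (N - 1) * τ) * m' ^ 2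
      ≤ (4 + 2 * N * (N - 1) * τ) * ((r + a) * (r' + b) - (k + m) ^ 2) := by
  have c1 : 2 * (k * m + k' * m') ≤ r * b + r' * a := two_mul_inner_le hr hr' ha hb hk hm
  -- Averaged with `c1`, this gives the bound by 2km alone that `h3` uses.
  have c2 : 2 * (k * m + -k' * m') ≤ r * b + r' * a :=
    two_mul_inner_le hr hr' ha hb (by rwa [neg_sq]) hm
  -- The vertical weight exceeds the horizontal holomorphic weight 4(1+τ) by this amount; here N ≥ 2
  -- is essential.
  have hδ : 0 ≤ (2 * N * (N - 1) - 4) * τ := mul_nonneg (by nlinarith) hτ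
  have h1 := mul_nonneg (add_nonneg hδ (by linarith : (0 : ℝ) ≤ 3 + 3 * τ)) (sub_nonneg.2 hk)
  have h2 := mul_nonneg hδ (sq_nonneg k')
  have h3 : 0 ≤ (2 * N * (N - 1) + 4 * N) * τ * (r * b + r' * a - 2 * (k * m)) :=
    mul_nonneg (mul_nonneg (by nlinarith) hτ) (by linarith)
  have h4 : 0 ≤ 3 * (1 - N * τ) * (r * b + r' * a - 2 * (k * m + k' * m')) :=
    mul_nonneg (by linarith) (by linarith)
  have h7 : a * b = m ^ 2 + m' ^ 2 := hm.symm
  have h8 : (4 + 2 * N * (N - 1) * τ) * (a * b)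
      = (4 + 2 * N * (N - 1) * τ) * (m ^ 2 + m' ^ 2) := by rw [h7]
  nlinarith [h1, h2, h3, h4, h8]

end Bounds

/-! ### The profile of the model metric and its largest root. -/

section ModelProfile

open ComplexConjugate

variable {n : ℕ} {α : ℝ}

theorem hasDerivAt_const_div_pow (c : ℝ) (m : ℕ) {s : ℝ} (hs : s ≠ 0) :
    HasDerivAt (fun x : ℝ => c / x ^ m) (-(m * c) / s ^ (m + 1)) s := by
  refine ((hasDerivAt_const s c).div (hasDerivAt_pow m s) (pow_ne_zero m hs)).congr_deriv ?_
  -- The power rule produces the truncated exponent m - 1, so m = 0 is separate.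
  cases m with
  | zero => simp
  | succ k =>
    push_cast
    field_simp
    simp
    ring

theorem contDiffOn_const_div_pow (c : ℝ) (m : ℕ) {s₀ : ℝ} (hs : 0 ≤ s₀) :
    ContDiffOn ℝ ∞ (fun x : ℝ => c / x ^ m) (Set.Ioi s₀) :=
  contDiffOn_const.div (contDiff_id.pow m).contDiffOn fun _ hx =>
    pow_ne_zero m (hs.trans_lt hx).ne'

theorem modelV_eq (n : ℕ) (α : ℝ) : modelV n α = fun u => u ^ 2 - 1 + α / (u ^ 2) ^ n := by
  funext u
  rw [modelV, pow_mul]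

/-- V is positive for u > 1 and V(1) = α > 0, so a nonpositive value beyond u_α would force a larger
root by the intermediate value theorem. -/
theorem modelV_pos (hn : 1 ≤ n) (hα : α ∈ Set.Ioo 0 (alphaMax n)) {u : ℝ}
    (hu : rootU n α < u) : 0 < modelV n α u := by
  have hg := isGreatest_rootU n hn α hα.1 hα.2.le
  have h0 : 0 < u := hg.1.1.trans hu
  by_contra! hle
  have hu1 : u ≤ 1 := by
    by_contra! h1
    have : 0 < α / u ^ (2 * n) := div_pos hα.1 (by positivity)
    rw [modelV] at hle
    nlinarith
  have hc : ContinuousOn (modelV n α) (Set.Icc u 1) := by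
    refine ((continuousOn_id.pow 2).sub continuousOn_const).add
      (continuousOn_const.div (continuousOn_id.pow _) fun x hx => ?_)
    exact pow_ne_zero _ (h0.trans_le hx.1).ne'
  obtain ⟨x, hx, hx0⟩ := intermediate_value_Icc hu1 hc ⟨hle, by simp [modelV, hα.1.le]⟩
  exact absurd (hg.2 ⟨h0.trans_le hx.1, hx0⟩) (not_le.2 (hu.trans_le hx.1))

theorem isWarpingProfile_model (hn : 1 ≤ n) (hα : α ∈ Set.Ioo 0 (alphaMax n)) :
    IsWarpingProfile (fun s => s - 1 + α / s ^ n) (fun s => 1 + -(n * α) / s ^ (n + 1))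
      (fun s => -((n + 1 : ℕ) * -(n * α)) / s ^ (n + 1 + 1)) (rootU n α ^ 2) where
  nonneg := sq_nonneg _
  pos s hs := by
    have hs0 : 0 ≤ s := (sq_nonneg _).trans hs.le
    have h := modelV_pos hn hα (u := √s) (Real.lt_sqrt_of_sq_lt hs)
    rwa [modelV, pow_mul, Real.sq_sqrt hs0] at h
  hasDerivAt s hs := ((hasDerivAt_id s).sub_const 1).add
    (hasDerivAt_const_div_pow α n ((sq_nonneg _).trans_lt hs).ne')
  hasDerivAt_deriv s hs :=
    (hasDerivAt_const_div_pow _ (n + 1) ((sq_nonneg _).trans_lt hs).ne').const_add 1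
  contDiffOn := (contDiffOn_id.sub contDiffOn_const).add
    (contDiffOn_const_div_pow α n (sq_nonneg _))
  contDiffOn_deriv := contDiffOn_const.add (contDiffOn_const_div_pow _ (n + 1) (sq_nonneg _))

theorem modelMetric_eq (n : ℕ) (α : ℝ) :
    modelMetric n α = warpedMetric n (fun u => (fun s => s - 1 + α / s ^ n) (u ^ 2)) := by
  rw [modelMetric, modelV_eq]

theorem modelDomain_eq (hn : 1 ≤ n) (hα : α ∈ Set.Ioo 0 (alphaMax n)) :
    modelDomain n α = profileDomain n (rootU n α ^ 2) := by
  have hg := isGreatest_rootU n hn α hα.1 hα.2.le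
  ext p
  exact and_congr_right fun _ =>
    (pow_lt_pow_iff_left₀ hg.1.1.le (norm_nonneg _) two_ne_zero).symm

/-- The largest root of `V` is at least the point `√(n / (n + 1))` where `u^{2n} V` is minimal. -/
theorem mul_div_rootU_pow_lt_one (hn : 1 ≤ n) (hα : α ∈ Set.Ioo 0 (alphaMax n)) :
    n * α / rootU n α ^ (2 * n + 2) < 1 := by
  have hg := isGreatest_rootU n hn α hα.1 hα.2.le
  have hn' : (0 : ℝ) < n := by exact_mod_cast hn
  obtain ⟨w, hw⟩ : ∃ w : ℝ, w = √(n / (n + 1)) := ⟨_, rfl⟩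
  have hw2 : w ^ 2 = n / (n + 1) := by rw [hw, Real.sq_sqrt (by positivity)]
  have hw0 : 0 < w := by rw [hw]; positivity
  have hmax : n * alphaMax n = w ^ (2 * n + 2) := by
    rw [alphaMax, ← hw, pow_add, hw2]
    field_simp
  have hle : w ≤ rootU n α := by
    by_contra! hlt
    have h1 := modelV_pos hn hα hlt
    have h2 : 0 < w ^ (2 * n) * modelV n α w := by positivity
    -- This value is negative, so V(w) < 0 and w cannot lie beyond the largest root.
    have h3 : w ^ (2 * n) * modelV n α w = α - alphaMax n := by
      rw [modelV, mul_add, mul_div_cancel₀ _ (by positivity), hw2, alphaMax, ← hw]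
      field_simp
      ring
    linarith [hα.2]
  rw [div_lt_one (pow_pos hg.1.1 _)]
  calc n * α < n * alphaMax n := by gcongr; exact hα.2
    _ = w ^ (2 * n + 2) := hmax
    _ ≤ rootU n α ^ (2 * n + 2) := by gcongr

/-- The curvature bounds of the model metric, in terms of `τ = α / u^{2n+2}`. -/
theorem sectionalCurvature_modelMetric_bounds (hn : 1 ≤ n) (hα : α ∈ Set.Ioo 0 (alphaMax n))
    {p : ModelSpace n} (hp : p ∈ modelDomain n α) {X Y : ModelSpace n}
    (hXY : LinearIndependent ℝ ![X, Y]) :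
    -(4 + 2 * n * (n - 1) * (α / ‖p.2‖ ^ (2 * n + 2)))
        ≤ sectionalCurvature (modelMetric n α) p X Y ∧
      sectionalCurvature (modelMetric n α) p X Y
        ≤ -(1 - n * (α / ‖p.2‖ ^ (2 * n + 2))) := by
  have hg := isGreatest_rootU n hn α hα.1 hα.2.le
  have hn' : (0 : ℝ) < n := by exact_mod_cast hn
  have hv := isWarpingProfile_model hn hα
  have hτ1 : n * (α / ‖p.2‖ ^ (2 * n + 2)) ≤ 1 := by
    rw [← mul_div_assoc]
    refine le_trans ?_ (mul_div_rootU_pow_lt_one hn hα).le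
    have := hα.1
    have := pow_pos hg.1.1 (2 * n + 2)
    have := hg.1.1.le
    have := hp.2.le
    gcongr
  rw [modelMetric_eq]
  rw [modelDomain_eq hn hα] at hp
  have hs := hv.norm_sq_pos hp
  have hvs := hv.pos _ hp.2
  have hR := hv.isRiemannianMetricOn (n := n)
  have hD := gram_pos (hR.symm p hp) (hR.pos p hp) hXY
  have hN := hv.warpedMetric_riemannCurvature hp X Y rfl rfl rfl
  rw [sectionalCurvature, hN, le_div_iff₀ hD, div_le_iff₀ hD]
  rw [hv.warpedMetric_eq hp, hv.warpedMetric_eq hp, hv.warpedMetric_eq hp]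
  have hcs := ballForm_cauchy_schwarz hp.1 X.1 Y.1
  have hX := ballForm_self_nonneg hp.1 X.1
  have hY := ballForm_self_nonneg hp.1 Y.1
  -- For n = 1 the ball is a point. This case is kept apart because `curvature_lower_bound` needs N
  -- ≥ 2.
  have hx0 : n = 1 → (ballForm p.1 X.1 X.1).re = 0 ∧ (ballForm p.1 X.1 Y.1).re = 0 ∧
      (ballForm p.1 X.1 Y.1).im = 0 ∧ (ballForm p.1 Y.1 Y.1).re = 0 := by
    rintro rfl
    have h1 : X.1 = 0 := Subsingleton.elim (α := EuclideanSpace ℂ (Fin 0)) _ _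
    have h2 : Y.1 = 0 := Subsingleton.elim (α := EuclideanSpace ℂ (Fin 0)) _ _
    simp [h1, h2, ballForm_zero_left]
  have hform : ∀ Z W : ModelSpace n,
      (frameForm (fun s => s - 1 + α / s ^ n) p (coframe (fun s => s - 1 + α / s ^ n) p Z)
        (coframe (fun s => s - 1 + α / s ^ n) p W)).re
      = ‖p.2‖ ^ 2 * (ballForm p.1 Z.1 W.1).re
        + ‖p.2‖ ^ 2 * (‖p.2‖ ^ 2 - 1 + α / (‖p.2‖ ^ 2) ^ n)
          * (conj (verticalForm (fun s => s - 1 + α / s ^ n) p Z)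
            * verticalForm (fun s => s - 1 + α / s ^ n) p W).re := by
    intro Z W
    rw [frameForm, Complex.add_re, Complex.re_ofReal_mul, Complex.re_ofReal_mul, coframe_apply,
      coframe_apply]
  have hself : ∀ c : ℂ, (conj c * c).re = Complex.normSq c := fun c => by
    rw [← Complex.normSq_eq_conj_mul_self, Complex.ofReal_re]
  rw [hform, hform, hform, hself, hself]
  have hpow : ‖p.2‖ ^ (2 * n + 2) = (‖p.2‖ ^ 2) ^ (n + 1) := by rw [← pow_mul]; ring
  rw [hpow] at hτ1 ⊢
  have hm : ∀ c d : ℂ, (conj c * d).re ^ 2 + (conj c * d).im ^ 2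
      = Complex.normSq c * Complex.normSq d := by
    intro c d
    rw [← Complex.normSq_conj c, ← Complex.normSq_mul, Complex.normSq_apply]
    ring
  have hm' := hm (verticalForm (fun s => s - 1 + α / s ^ n) p X)
    (verticalForm (fun s => s - 1 + α / s ^ n) p Y)
  have ha := Complex.normSq_nonneg (verticalForm (fun s => s - 1 + α / s ^ n) p X)
  have hb := Complex.normSq_nonneg (verticalForm (fun s => s - 1 + α / s ^ n) p Y)
  generalize Complex.normSq (verticalForm (fun s => s - 1 + α / s ^ n) p X) = a at *
  generalize Complex.normSq (verticalForm (fun s => s - 1 + α / s ^ n) p Y) = b at *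
  generalize conj (verticalForm (fun s => s - 1 + α / s ^ n) p X)
    * verticalForm (fun s => s - 1 + α / s ^ n) p Y = m at *
  clear hform hself hm hN hD hR hv hpow hg
  obtain ⟨r, hr⟩ : ∃ r, r = (ballForm p.1 X.1 X.1).re := ⟨_, rfl⟩
  obtain ⟨r', hr'⟩ : ∃ r, r = (ballForm p.1 Y.1 Y.1).re := ⟨_, rfl⟩
  rw [← hr] at hX hcs hx0 ⊢
  rw [← hr'] at hY hcs hx0 ⊢
  generalize ballForm p.1 X.1 Y.1 = k at *
  clear hr hr'
  have hτ : 0 ≤ α / (‖p.2‖ ^ 2) ^ (n + 1) := div_nonneg hα.1.le (by positivity)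
  have e1 : ∀ s : ℝ, 0 < s → 1 + (s - 1 + α / s ^ n) = s * (1 + α / s ^ (n + 1)) := by
    intro s hs
    field_simp
    ring
  have e2 : 1 + -(n * α) / (‖p.2‖ ^ 2) ^ (n + 1) = 1 - n * (α / (‖p.2‖ ^ 2) ^ (n + 1)) := by ring
  have e3 : ∀ s : ℝ, 0 < s → s * (-((n + 1 : ℕ) * -(n * α)) / s ^ (n + 1 + 1))
      = n * (n + 1) * (α / s ^ (n + 1)) := by
    intro s hs
    push_cast
    field_simp
    ring
  rw [e3 _ hs, e1 _ hs, e2]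
  generalize α / (‖p.2‖ ^ 2) ^ (n + 1) = τ at *
  generalize ‖p.2‖ ^ 2 - 1 + α / (‖p.2‖ ^ 2) ^ n = V at *
  generalize ‖p.2‖ ^ 2 = s at *
  -- Scaling the ball quantities by s and the vertical ones by sV gives the components of the metric
  -- itself, the variables of the two algebraic bounds.
  have hk2 : (s * k.re) ^ 2 + (s * k.im) ^ 2 ≤ s * r * (s * r') := by
    nlinarith [mul_le_mul_of_nonneg_left hcs (sq_nonneg s)]
  have hm2 : (s * V * m.re) ^ 2 + (s * V * m.im) ^ 2 = s * V * a * (s * V * b) := by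
    linear_combination (s * V) ^ 2 * hm'
  constructor
  · rcases hn.eq_or_lt with h1 | h1
    · obtain ⟨h2, h3, h4, h5⟩ := hx0 h1.symm
      rw [h2, h3, h4, h5, ← h1]
      -- With only the vertical terms left, the curvature equals -4 and the lower bound is an
      -- equality.
      push_cast
      linear_combination 4 * hm2
    · have h2 : (2 : ℝ) ≤ n := by exact_mod_cast h1
      have := curvature_lower_bound (r := s * r) (r' := s * r') (a := s * V * a) (b := s * V * b)
        h2 hτ hτ1 (by positivity) (by positivity) (mul_nonneg (mul_pos hs hvs).le ha)
        (mul_nonneg (mul_pos hs hvs).le hb) hk2 hm2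
      linarith
  · have := curvature_upper_bound (N := n) hn'.le hτ hτ1 hk2 hm2
    linarith

end ModelProfile

/-! ### Conclusion. -/

theorem proposition3p7 (n : ℕ) (hn : 1 ≤ n) (α : ℝ) (hα : α ∈ Set.Ioo 0 (alphaMax n)) :
    IsRiemannianMetricOn (modelMetric n α) (modelDomain n α) ∧
    (∃ κ : ℝ, 0 < κ ∧ ∀ p ∈ modelDomain n α, ∀ X Y : ModelSpace n,
      LinearIndependent ℝ ![X, Y] → sectionalCurvature (modelMetric n α) p X Y ≤ -κ) ∧
    (∀ p ∈ modelDomain n α, ∀ X Y : ModelSpace n, LinearIndependent ℝ ![X, Y] →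
      -4 - 2 * (n : ℝ) * ((n : ℝ) - 1) * α / ‖p.2‖ ^ (2 * n + 2)
          ≤ sectionalCurvature (modelMetric n α) p X Y ∧
        sectionalCurvature (modelMetric n α) p X Y
          ≤ -1 + (n : ℝ) * α / ‖p.2‖ ^ (2 * n + 2)) := by
  -- κ is the pointwise bound 1 - nτ evaluated at u = u_α; τ decreases in u, so it serves for the
  -- whole domain.
  refine ⟨?_, ⟨1 - n * α / rootU n α ^ (2 * n + 2),
    sub_pos.2 (mul_div_rootU_pow_lt_one hn hα), ?_⟩, ?_⟩
  · rw [modelMetric_eq, modelDomain_eq hn hα]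
    exact (isWarpingProfile_model hn hα).isRiemannianMetricOn
  · intro p hp X Y hXY
    refine (sectionalCurvature_modelMetric_bounds hn hα hp hXY).2.trans ?_
    have hg := (isGreatest_rootU n hn α hα.1 hα.2.le).1.1
    have : n * α / ‖p.2‖ ^ (2 * n + 2) ≤ n * α / rootU n α ^ (2 * n + 2) := by
      have := hα.1
      have := pow_pos hg (2 * n + 2)
      have := hg.le
      have := hp.2.le
      gcongr
    rw [← mul_div_assoc]
    linarith
  · intro p hp X Y hXY
    obtain ⟨h1, h2⟩ := sectionalCurvature_modelMetric_bounds hn hα hp hXY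
    rw [← mul_div_assoc] at h1 h2
    constructor <;> linarith
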